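/- Let $\mathcal T=(V,E,F)$ be a (simplicial) triangulation of a closed surface with vertices $v_1,\dots,v_N$, and let $\Phi:E\to[0,\pi)$ be a weight such that, with $I_{ij}=\cos\Phi_{ij}$, $$I_{ij}+I_{ik}I_{jk}\ge 0,\qquad I_{ik}+I_{ij}I_{jk}\ge 0,\qquad I_{jk}+I_{ij}I_{ik}\ge 0\qquad\text{for every triangle }\triangle_{ijk}\in F.$$ For $r\in\mathbb R^N_{>0}$ (a circle packing metric) let the edge $e_{ij}$ have hyperbolic length $l_{ij}=\cosh^{-1}(\cosh r_i\cosh r_j+\sinh r_i\sinh r_j\cos\Phi_{ij})$, let $\theta_i^{jk}$ be the angle at $v_i$ of the hyperbolic triangle $\triangle_{ijk}$ with side lengths $l_{ij},l_{ik},l_{jk}$, let $\operatorname{Area}(\triangle_{ijk})=\pi-\theta_i^{jk}-\theta_j^{ik}-\theta_k^{ij}$, and let $K_i=2\pi-\sum_{\triangle_{ijk}\in F}\theta_i^{jk}$ be the combinatorial curvature at $v_i$, the sum being over the triangles that contain $v_i$. Put $u_i=\ln\tanh(r_i/2)$, so that $\partial/\partial u_i=\sinh r_i\,\partial/\partial r_i$,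 and $$B_{ij}=\frac{\partial(\theta_i^{jk}+\theta_i^{jl})}{\partial u_j}\quad(e_{ij}\in E),\qquad A_i=\frac{\partial}{\partial u_i}\sum_{\triangle_{ijk}\in F}\operatorname{Area}(\triangle_{ijk}),$$ where $\triangle_{ijk},\triangle_{ijl}$ are the two triangles containing $e_{ij}$, and the sum in $A_i$ is over the triangles containing $v_i$. For $f:V\to\mathbb R$ and $p>1$ put $$\Delta f_i=-\sum_{j=1}^N\frac{\partial K_j}{\partial u_i}f_j,\qquad \Delta_pf_i=\sum_{v_j\sim v_i}B_{ij}|f_j-f_i|^{p-2}(f_j-f_i)-A_if_i,$$ where terms with $f_j=f_i$ are $0$. Then for every initial circle packing metric $r(0)\in\mathbb R^N_{>0}$, the solution to the combinatorial Calabi flow $u_i'(t)=\Delta K_i$ and, for every $p>1$, the solution to the combinatorial $p$-th Calabi flow $u_i'(t)=\Delta_pK_i$ exists for all $t\in[0,\infty)$. That is, for each of these flows there is a solution $r:[0,\infty)\to\mathbb R^N_{>0}$ with the given initial value, and every solution with this initial value on an interval $[0,\tau)$, $\tau>0$, extends to a solution on $[0,\infty)$. -/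

import Mathlib

open Finset

/-- A (simplicial) triangulation of a closed surface with vertex set `V`, not necessarily connected:
a finite set of triangles such that every edge lies in exactly two triangles and the link of every
vertex is connected. Each link is then a finite connected graph in which all vertices have
degree two, i.e. a cycle. -/
structure SurfaceTriangulation (V : Type*) [Fintype V] [DecidableEq V] where
  /-- The triangles, as sets of vertices. -/
  faces : Finset (Finset V)
  card_face : ∀ σ ∈ faces, σ.card = 3
  /-- Every edge lies in exactly two triangles. -/
  card_faces_of_edge : ∀ e : Finset V, e.card = 2 → (∃ σ ∈ faces, e ⊆ σ) →
    (faces.filter (fun σ => e ⊆ σ)).card = 2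
  /-- The link of a vertex `i` (vertices: the neighbours of `i`; edges: the sides opposite to `i`
  of the triangles at `i`) is connected; in particular it is not empty. -/
  link_connected : ∀ i : V,
    (SimpleGraph.fromRel (fun j k : {j : V // j ≠ i ∧ ∃ σ ∈ faces, i ∈ σ ∧ j ∈ σ} =>
      ({i, j.1, k.1} : Finset V) ∈ faces)).Connected

namespace SurfaceTriangulation

variable {V : Type*} [Fintype V] [DecidableEq V]

/-- The edges, as sets of two vertices; `v_i ∼ v_j` means `{i, j} ∈ T.edges`. -/
def edges (T : SurfaceTriangulation V) : Finset (Finset V) :=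
  univ.filter (fun e => e.card = 2 ∧ ∃ σ ∈ T.faces, e ⊆ σ)

/-- A weight assigns to every edge an angle in `[0, π)`. Values off the edges are irrelevant. -/
def IsWeight (T : SurfaceTriangulation V) (Φ : Finset V → ℝ) : Prop :=
  ∀ e ∈ T.edges, 0 ≤ Φ e ∧ Φ e < Real.pi

/-- The condition `I_ij + I_ik I_jk ≥ 0`, `I_ik + I_ij I_jk ≥ 0`, `I_jk + I_ij I_ik ≥ 0` with
`I = cos Φ`, for all triangles (the three inequalities are permutations of one another). -/
def StarCondition (T : SurfaceTriangulation V) (Φ : Finset V → ℝ) : Prop :=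
  ∀ i j k : V, ({i, j, k} : Finset V) ∈ T.faces →
    0 ≤ Real.cos (Φ {i, j}) + Real.cos (Φ {i, k}) * Real.cos (Φ {j, k})

end SurfaceTriangulation

noncomputable section

namespace CirclePacking

variable {V : Type*} [Fintype V] [DecidableEq V]

/-- The hyperbolic length of the edge `e = {i, j}`:
`cosh l_ij = cosh r_i cosh r_j + cos Φ_ij sinh r_i sinh r_j`. -/
def edgeLength (Φ : Finset V → ℝ) (r : V → ℝ) (e : Finset V) : ℝ :=
  Real.arcosh ((∏ v ∈ e, Real.cosh (r v)) + (∏ v ∈ e, Real.sinh (r v)) * Real.cos (Φ e))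

/-- The interior angle `θ_i^{jk}` at the vertex `i` of the hyperbolic triangle `σ = {i, j, k}` with
side lengths `l_ij, l_ik, l_jk`, by the hyperbolic law of cosines
`cos θ = (cosh l_ij cosh l_ik - cosh l_jk) / (sinh l_ij sinh l_ik)`. -/
def angle (Φ : Finset V → ℝ) (r : V → ℝ) (σ : Finset V) (i : V) : ℝ :=
  Real.arccos
    (((∏ j ∈ σ.erase i, Real.cosh (edgeLength Φ r {i, j})) -
        Real.cosh (edgeLength Φ r (σ.erase i))) /
      ∏ j ∈ σ.erase i, Real.sinh (edgeLength Φ r {i, j}))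

/-- The area of a hyperbolic triangle: `π` minus the sum of its angles. -/
def area (Φ : Finset V → ℝ) (r : V → ℝ) (σ : Finset V) : ℝ :=
  Real.pi - ∑ v ∈ σ, angle Φ r σ v

/-- The combinatorial Gauss curvature `K_i`. -/
def curvature (T : SurfaceTriangulation V) (Φ : Finset V → ℝ) (r : V → ℝ) (i : V) : ℝ :=
  2 * Real.pi - ∑ σ ∈ T.faces.filter (fun σ => i ∈ σ), angle Φ r σ i

/-- The coordinate `u = log tanh (r / 2)`, for which `∂/∂u = sinh r ∂/∂r`. -/
def uCoord (x : ℝ) : ℝ := Real.log (Real.tanh (x / 2))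

/-- `∂f/∂u_j = sinh r_j ∂f/∂r_j` at the circle packing metric `r`. -/
def partialU (f : (V → ℝ) → ℝ) (r : V → ℝ) (j : V) : ℝ :=
  Real.sinh (r j) * deriv (fun s => f (Function.update r j s)) (r j)

/-- `B_ij = ∂(θ_i^{jk} + θ_i^{jl})/∂u_j`, where `ijk` and `ijl` are the triangles at the edge
`ij`. -/
def coeffB (T : SurfaceTriangulation V) (Φ : Finset V → ℝ) (r : V → ℝ) (i j : V) : ℝ :=
  partialU (fun s => ∑ σ ∈ T.faces.filter (fun σ => {i, j} ⊆ σ), angle Φ s σ i) r j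

/-- `A_i = ∂(∑ Area(ijk))/∂u_i`, the sum being over the triangles at `i`. -/
def coeffA (T : SurfaceTriangulation V) (Φ : Finset V → ℝ) (r : V → ℝ) (i : V) : ℝ :=
  partialU (fun s => ∑ σ ∈ T.faces.filter (fun σ => i ∈ σ), area Φ s σ) r i

/-- The discrete Laplacian `Δ f_i = - ∑_j (∂K_j/∂u_i) f_j`. -/
def laplacian (T : SurfaceTriangulation V) (Φ : Finset V → ℝ) (r : V → ℝ) (f : V → ℝ) (i : V) : ℝ :=
  - ∑ j, partialU (fun s => curvature T Φ s j) r i * f j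

/-- The discrete `p`-Laplacian
`Δ_p f_i = ∑_{j ∼ i} B_ij |f_j - f_i|^{p-2} (f_j - f_i) - A_i f_i`
(a term with `f_j = f_i` is `0`, also for `p < 2`). -/
def pLaplacian (T : SurfaceTriangulation V) (Φ : Finset V → ℝ) (p : ℝ) (r : V → ℝ) (f : V → ℝ)
    (i : V) : ℝ :=
  (∑ j ∈ univ.filter (fun j => {i, j} ∈ T.edges),
      coeffB T Φ r i j * (|f j - f i| ^ (p - 2) * (f j - f i))) -
    coeffA T Φ r i * f i

/-- `r`, restricted to the time interval `I`, is a curve of circle packing metrics with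
`u_i'(t) = X_i(r(t))` (one-sided derivatives at end points of `I` that belong to `I`). -/
def IsSolutionOn (X : (V → ℝ) → V → ℝ) (I : Set ℝ) (r : ℝ → V → ℝ) : Prop :=
  ∀ t ∈ I, ∀ i, 0 < r t i ∧ HasDerivWithinAt (fun s => uCoord (r s i)) (X (r t) i) I t

/-- The combinatorial Calabi flow `u' = ΔK` on the time interval `I`. -/
def IsCalabiFlow (T : SurfaceTriangulation V) (Φ : Finset V → ℝ) (I : Set ℝ) (r : ℝ → V → ℝ) :
    Prop :=
  IsSolutionOn (fun r => laplacian T Φ r (curvature T Φ r)) I r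

/-- The combinatorial `p`-th Calabi flow `u' = Δ_p K` on the time interval `I`. -/
def IsPCalabiFlow (T : SurfaceTriangulation V) (Φ : Finset V → ℝ) (p : ℝ) (I : Set ℝ)
    (r : ℝ → V → ℝ) : Prop :=
  IsSolutionOn (fun r => pLaplacian T Φ p r (curvature T Φ r)) I r

/-- Long time existence from the initial value `r₀`, for a flow given by its solutions on time
intervals: there is a solution on `[0, ∞)`, and every solution on some `[0, τ)`, `τ > 0`, extends
to a solution on `[0, ∞)` (no solution ceases to exist in finite time). -/
def LongTimeExistence (IsFlow : Set ℝ → (ℝ → V → ℝ) → Prop) (r₀ : V → ℝ) : Prop :=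
  (∃ r : ℝ → V → ℝ, r 0 = r₀ ∧ IsFlow (Set.Ici 0) r) ∧
  ∀ τ : ℝ, 0 < τ → ∀ ρ : ℝ → V → ℝ, ρ 0 = r₀ → IsFlow (Set.Ico 0 τ) ρ →
    ∃ r : ℝ → V → ℝ, Set.EqOn r ρ (Set.Ico 0 τ) ∧ IsFlow (Set.Ici 0) r

end CirclePacking

end

/-! Write w for ∂θ_i/∂u_j inside one face. It is nonnegative, symmetric in i and j, and satisfies
∂θ_i/∂u_i = -∑_j w cosh l_ij. Both flows therefore have one form (`pLaplacian_eq`): u_i' is the sum,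
over the faces at i and the other vertices j of each face, of w · (|K_j - K_i|^(p-2)(K_j - K_i) -
(cosh l_ij - 1) K_i). The Calabi flow is the case p = 2 (`laplacian_eq_pLaplacian_two`).

Radii do not blow up. When r_i is large, all angles at i are small whatever the other radii are, so
K_i ≥ π while K_j ≤ 2π. The term in cosh l_ij then dominates and u_i' ≤ 0 (`exists_barrier`).

Radii do not reach 0. This would mean u_i → -∞, but w stays bounded as long as the radii are bounded
above, even when they degenerate to 0 (`exists_weight_bound`). Hence u' is bounded and u changes at
most linearly in time.

For p < 2 the field need not be locally Lipschitz, so existence comes from Peano's theorem and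
uniqueness is not available. A solution on [0, τ) is instead extended by hand: it is Lipschitz in u,
has a limit at τ, and is continued from there. -/

namespace BoundedField

open Filter Topology Set

/-! ### Peano's theorem by Euler polygons. -/

section Euler

variable {E : Type*} [NormedAddCommGroup E] [NormedSpace ℝ E]

/-- The Euler polygon with step size `h`. -/
def euler (F : E → E) (h : ℝ) (x₀ : E) : ℕ → E
  | 0 => x₀
  | k + 1 => euler F h x₀ k + h • F (euler F h x₀ k)

/-- As long as the field stays ε-close to a fixed v, the polygon follows the motion with velocity v
up to ε times the elapsed time. With v = 0 this is a Lipschitz bound; with v = F (u a) it yields the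
derivative of the limit. -/
theorem norm_euler_sub_le {F : E → E} {h ε : ℝ} (hh : 0 ≤ h) {x₀ v : E} {k m : ℕ} (hkm : k ≤ m)
    (hv : ∀ j, k ≤ j → j < m → ‖F (euler F h x₀ j) - v‖ ≤ ε) :
    ‖euler F h x₀ m - euler F h x₀ k - (((m : ℝ) - k) * h) • v‖ ≤ ε * (((m : ℝ) - k) * h) := by
  induction m, hkm using Nat.le_induction with
  | base => simp
  | succ m hkm ih =>
    have h1 := ih fun j hj hjm => hv j hj (by omega)
    have h2 := hv m hkm (by omega)
    have h3 : euler F h x₀ (m + 1) - euler F h x₀ k - ((((m + 1 : ℕ) : ℝ) - k) * h) • v =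
        (euler F h x₀ m - euler F h x₀ k - (((m : ℝ) - k) * h) • v) +
          h • (F (euler F h x₀ m) - v) := by
      simp only [euler]
      push_cast
      module
    rw [h3]
    refine (norm_add_le _ _).trans ?_
    rw [norm_smul, Real.norm_of_nonneg hh]
    push_cast
    nlinarith [mul_le_mul_of_nonneg_left h2 hh]

theorem norm_euler_sub_le_abs {F : E → E} {h C : ℝ} (hh : 0 ≤ h) (hC : ∀ x, ‖F x‖ ≤ C) (x₀ : E)
    (k m : ℕ) : ‖euler F h x₀ m - euler F h x₀ k‖ ≤ C * (|(m : ℝ) - k| * h) := by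
  rcases le_total k m with hkm | hkm
  · have := norm_euler_sub_le (v := 0) (x₀ := x₀) hh hkm (fun j _ _ => by simpa using hC _)
    have hk : (k : ℝ) ≤ m := by exact_mod_cast hkm
    simpa [abs_of_nonneg (sub_nonneg.2 hk)] using this
  · have := norm_euler_sub_le (v := 0) (x₀ := x₀) hh hkm (fun j _ _ => by simpa using hC _)
    have hk : (m : ℝ) ≤ k := by exact_mod_cast hkm
    rw [norm_sub_rev, abs_sub_comm]
    simpa [abs_of_nonneg (sub_nonneg.2 hk)] using this

/-- **Peano's theorem** for bounded continuous vector fields: solutions exist for all times. -/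
theorem exists_forall_hasDerivWithinAt [ProperSpace E] {F : E → E} (hF : Continuous F) {C : ℝ}
    (hC : ∀ x, ‖F x‖ ≤ C) (x₀ : E) :
    ∃ u : ℝ → E, u 0 = x₀ ∧ ∀ t, 0 ≤ t → HasDerivWithinAt u (F (u t)) (Ici 0) t := by
  have hC0 : 0 ≤ C := (norm_nonneg _).trans (hC 0)
  set h : ℕ → ℝ := fun n => 1 / ((n : ℝ) + 1) with hh
  have hpos : ∀ n, 0 < h n := fun n => by positivity
  set N : ℝ → ℕ → ℕ := fun t n => ⌊t * ((n : ℝ) + 1)⌋₊ with hN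
  set w : ℝ → ℕ → E := fun t n => euler F (h n) x₀ (N t n) with hw
  have hN1 : ∀ t, 0 ≤ t → ∀ n, (N t n : ℝ) * h n ≤ t := fun t ht n => by
    have := Nat.floor_le (show 0 ≤ t * ((n : ℝ) + 1) by positivity)
    simp only [hN, hh, mul_one_div]
    rw [div_le_iff₀ (by positivity)]
    exact this
  have hN2 : ∀ t, 0 ≤ t → ∀ n, t ≤ (N t n : ℝ) * h n + h n := fun t ht n => by
    have := (Nat.lt_floor_add_one (t * ((n : ℝ) + 1))).le
    simp only [hN, hh]
    rw [← add_one_mul, mul_one_div, le_div_iff₀ (by positivity)]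
    exact this
  have hlim : Tendsto h (hyperfilter ℕ) (𝓝 0) :=
    tendsto_one_div_add_atTop_nhds_zero_nat.mono_left Nat.hyperfilter_le_atTop
  have hNlim : ∀ t, 0 ≤ t → Tendsto (fun n => (N t n : ℝ) * h n) (hyperfilter ℕ) (𝓝 t) :=
    fun t ht => by
      refine tendsto_of_tendsto_of_tendsto_of_le_of_le (g := fun n => t - h n) (h := fun _ => t)
        ?_ tendsto_const_nhds (fun n => ?_) (fun n => hN1 t ht n)
      · simpa using tendsto_const_nhds.sub hlim
      · simpa using sub_le_iff_le_add.2 (hN2 t ht n)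
  -- Limits along a nonprincipal ultrafilter exist for every t at once by compactness of balls, so
  -- no subsequence has to be extracted.
  have hex : ∀ t, ∃ y, 0 ≤ t → Tendsto (w t) (hyperfilter ℕ) (𝓝 y) := fun t => by
    by_cases ht : 0 ≤ t
    · have hmem : ∀ n, w t n ∈ Metric.closedBall x₀ (C * t) := fun n => by
        rw [mem_closedBall_iff_norm]
        have := norm_euler_sub_le_abs (hpos n).le hC x₀ 0 (N t n)
        simp only [euler, Nat.cast_zero, sub_zero, Nat.abs_cast] at this
        exact this.trans (mul_le_mul_of_nonneg_left (hN1 t ht n) hC0)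
      obtain ⟨y, -, hy⟩ := (isCompact_closedBall x₀ (C * t)).ultrafilter_le_nhds
        ((hyperfilter ℕ).map (w t)) (tendsto_principal.2 (Eventually.of_forall hmem))
      exact ⟨y, fun _ => hy⟩
    · exact ⟨0, fun h => absurd h ht⟩
  choose u hu using hex
  refine ⟨u, ?_, fun a ha => ?_⟩
  · refine tendsto_nhds_unique (hu 0 le_rfl) ?_
    have : w 0 = fun _ => x₀ := by
      funext n
      simp [hw, hN, euler]
    rw [this]
    exact tendsto_const_nhds
  have key : ∀ ε > 0, ∃ δ > 0, ∀ t s, 0 ≤ t → t ≤ s → |t - a| < δ → |s - a| < δ →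
      ‖u s - u t - (s - t) • F (u a)‖ ≤ ε * (s - t) := by
    intro ε hε
    obtain ⟨η, hη, hηF⟩ := Metric.continuousAt_iff.1 (hF.continuousAt (x := u a)) ε hε
    -- The distance of a polygon vertex to u a splits into three parts of size η / 3: convergence at
    -- time a, the movement during δ, and the movement during one time step.
    refine ⟨η / (3 * (C + 1)), by positivity, fun t s ht hts hta hsa => ?_⟩
    have hδ : C * (η / (3 * (C + 1))) ≤ η / 3 := by
      have : (C + 1) * (η / (3 * (C + 1))) = η / 3 := by field_simp
      have h0 : 0 < η / (3 * (C + 1)) := by positivity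
      nlinarith
    have e1 : ∀ᶠ n in (hyperfilter ℕ : Filter ℕ), dist (w a n) (u a) < η / 3 :=
      Metric.tendsto_nhds.1 (hu a ha) _ (by positivity)
    have e2 : ∀ᶠ n in (hyperfilter ℕ : Filter ℕ), C * h n < η / 3 := by
      have : Tendsto (fun n => C * h n) (hyperfilter ℕ) (𝓝 0) := by simpa using hlim.const_mul C
      exact this.eventually_lt_const (by positivity)
    have hb : ∀ᶠ n in (hyperfilter ℕ : Filter ℕ),
        ‖w s n - w t n - (((N s n : ℝ) - N t n) * h n) • F (u a)‖ ≤
          ε * (((N s n : ℝ) - N t n) * h n) := by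
      filter_upwards [e1, e2] with n h1 h2
      have hNm : N t n ≤ N s n :=
        Nat.floor_mono (mul_le_mul_of_nonneg_right hts (by positivity))
      refine norm_euler_sub_le (hpos n).le hNm fun j hj hjm => ?_
      rw [← dist_eq_norm]
      refine (hηF ?_).le
      have hj1 : (N t n : ℝ) * h n ≤ j * h n :=
        mul_le_mul_of_nonneg_right (by exact_mod_cast hj) (hpos n).le
      have hj2 : (j : ℝ) * h n ≤ N s n * h n :=
        mul_le_mul_of_nonneg_right (by exact_mod_cast hjm.le) (hpos n).le
      have h3 : |(j : ℝ) - N a n| * h n ≤ η / (3 * (C + 1)) + h n := by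
        rw [← abs_of_pos (hpos n), ← abs_mul, abs_of_pos (hpos n), sub_mul]
        have := hN1 a ha n
        have := hN2 a ha n
        have := hN2 t ht n
        have := hN1 s (ht.trans hts) n
        rw [abs_lt] at hta hsa
        rw [abs_le]
        constructor <;> linarith
      have h4 := norm_euler_sub_le_abs (hpos n).le hC x₀ (N a n) j
      have h5 := mul_le_mul_of_nonneg_left h3 hC0
      rw [← dist_eq_norm] at h4
      calc dist (euler F (h n) x₀ j) (u a) ≤ dist (euler F (h n) x₀ j) (w a n) + dist (w a n) (u a) :=
            dist_triangle _ _ _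
        _ < η := by linarith
    have hl : Tendsto (fun n => ((N s n : ℝ) - N t n) * h n) (hyperfilter ℕ) (𝓝 (s - t)) := by
      simpa [sub_mul] using (hNlim s (ht.trans hts)).sub (hNlim t ht)
    exact le_of_tendsto_of_tendsto
      (((hu s (ht.trans hts)).sub (hu t ht)).sub (hl.smul_const _)).norm (hl.const_mul ε) hb
  rw [hasDerivWithinAt_iff_isLittleO, Asymptotics.isLittleO_iff]
  intro ε hε
  obtain ⟨δ, hδ, hk⟩ := key ε hε
  have hball : ∀ᶠ s in 𝓝[Ici 0] a, |s - a| < δ :=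
    mem_nhdsWithin_of_mem_nhds (Metric.ball_mem_nhds a hδ)
  filter_upwards [hball, self_mem_nhdsWithin] with s hs hs0
  rcases le_total a s with has | has
  · have := hk a s ha has (by simpa using hδ) hs
    rwa [Real.norm_of_nonneg (sub_nonneg.2 has)]
  · have := hk s a hs0 has hs (by simpa using hδ)
    rw [Real.norm_of_nonpos (sub_nonpos.2 has), neg_sub]
    rwa [← norm_neg, show -(u s - u a - (s - a) • F (u a)) = u a - u s - (a - s) • F (u a) by module]

end Euler

/-! ### Flows with a barrier from above. -/

theorem le_of_deriv_nonpos_above {g g' : ℝ → ℝ} {M b : ℝ} (hb : 0 ≤ b)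
    (hg : ContinuousOn g (Icc 0 b)) (hg' : ∀ x ∈ Ico 0 b, HasDerivWithinAt g (g' x) (Ici x) x)
    (h0 : g 0 ≤ M) (hM : ∀ x ∈ Ico 0 b, M ≤ g x → g' x ≤ 0) : g b ≤ M := by
  refine le_of_forall_pos_le_add fun ε hε => ?_
  -- Comparison needs a strict inequality of slopes, so the level M is replaced by a line of small
  -- positive slope that rises by at most ε up to time b.
  have hε' : 0 < ε / (b + 1) := by positivity
  have := image_le_of_deriv_right_lt_deriv_boundary' (B := fun x => M + ε / (b + 1) * x)
    (B' := fun _ => ε / (b + 1)) hg hg' (by simpa using h0) (by fun_prop)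
    (fun x _ => by
      simpa using (((hasDerivAt_id x).const_mul (ε / (b + 1))).const_add M).hasDerivWithinAt)
    (fun x hx hxe => (hM x hx (by rw [hxe]; have := mul_nonneg hε'.le hx.1; linarith)).trans_lt hε')
    (right_mem_Icc.2 hb)
  refine this.trans ?_
  have h1 : ε / (b + 1) * b ≤ ε := by
    rw [div_mul_eq_mul_div, div_le_iff₀ (by positivity)]
    nlinarith
  linarith

section Flow

variable {ι : Type*}

/-- `u` is an integral curve of `F` on `I` with negative coordinates. -/
def IsNegSolutionOn (F : (ι → ℝ) → ι → ℝ) (I : Set ℝ) (u : ℝ → ι → ℝ) : Prop :=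
  ∀ t ∈ I, ∀ i, u t i < 0 ∧ HasDerivWithinAt (fun s => u s i) (F (u t) i) I t

variable {F : (ι → ℝ) → ι → ℝ} {m : ℝ}

theorem IsNegSolutionOn.le_of_barrier {I : Set ℝ} {u : ℝ → ι → ℝ} {M b : ℝ}
    (hu : IsNegSolutionOn F I u) (hI : Icc 0 b ⊆ I) (hIn : ∀ x ∈ Ico 0 b, I ∈ 𝓝[≥] x)
    (hbar : ∀ x : ι → ℝ, (∀ i, x i < 0) → ∀ i, M ≤ x i → F x i ≤ 0) (hb : 0 ≤ b)
    (h0 : ∀ i, u 0 i ≤ M) (i : ι) : u b i ≤ M :=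
  le_of_deriv_nonpos_above (g := fun t => u t i) hb
    (fun x hx => (hu x (hI hx) i).2.continuousWithinAt.mono hI)
    (fun x hx => (hu x (hI (Ico_subset_Icc_self hx)) i).2.mono_of_mem_nhdsWithin (hIn x hx)) (h0 i)
    (fun x hx hMx => hbar (u x) (fun j => (hu x (hI (Ico_subset_Icc_self hx)) j).1) i hMx)

variable [Fintype ι]

theorem exists_neg_bound (hm : m < 0) {x₀ : ι → ℝ} (hx₀ : ∀ i, x₀ i < 0) :
    ∃ M < 0, m ≤ M ∧ ∀ i, x₀ i ≤ M := by
  have h : ∀ y < (0 : ℝ), ∀ᶠ M in 𝓝[<] (0 : ℝ), y ≤ M := fun y hy =>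
    mem_nhdsWithin_of_mem_nhds (Ici_mem_nhds hy)
  obtain ⟨M, hM0, hmM, hM⟩ := ((eventually_mem_nhdsWithin (a := (0 : ℝ)) (s := Iio 0)).and
    ((h m hm).and (eventually_all.2 fun i => h _ (hx₀ i)))).exists
  exact ⟨M, hM0, hmM, hM⟩

theorem exists_isNegSolutionOn_Ici (hm : m < 0)
    (hcont : ContinuousOn F {x | ∀ i, x i < 0})
    (hbar : ∀ x : ι → ℝ, (∀ i, x i < 0) → ∀ i, m ≤ x i → F x i ≤ 0)
    (hbdd : ∀ M < 0, ∃ C, ∀ x : ι → ℝ, (∀ i, x i ≤ M) → ∀ i, |F x i| ≤ C)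
    {x₀ : ι → ℝ} (hx₀ : ∀ i, x₀ i < 0) : ∃ u, u 0 = x₀ ∧ IsNegSolutionOn F (Ici 0) u := by
  obtain ⟨M, hM0, hmM, hM⟩ := exists_neg_bound hm hx₀
  obtain ⟨C, hC⟩ := hbdd M hM0
  -- Capping the coordinates at M makes the field bounded and continuous on the whole space. The
  -- barrier survives, since a coordinate above M is evaluated at M ≥ m, so solutions of the capped
  -- equation stay where the cap does nothing.
  set c : (ι → ℝ) → ι → ℝ := fun x i => min (x i) M with hc
  have hcM : ∀ x i, c x i ≤ M := fun x i => min_le_right _ _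
  have hY : Continuous fun x => F (c x) :=
    hcont.comp_continuous (by fun_prop) fun x i => (hcM x i).trans_lt hM0
  obtain ⟨u, hu0, hu⟩ := exists_forall_hasDerivWithinAt (F := fun x => F (c x)) hY (C := max C 0)
    (fun x => (pi_norm_le_iff_of_nonneg (le_max_right _ _)).2 fun i =>
      (hC _ (hcM x) i).trans (le_max_left _ _)) x₀
  have hui : ∀ t, 0 ≤ t → ∀ i, HasDerivWithinAt (fun s => u s i) (F (c (u t)) i) (Ici 0) t :=
    fun t ht => hasDerivWithinAt_pi.1 (hu t ht)
  have hle : ∀ t, 0 ≤ t → ∀ i, u t i ≤ M := fun t ht i =>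
    le_of_deriv_nonpos_above (g := fun t => u t i) ht
      (fun x hx => (hui x hx.1 i).continuousWithinAt.mono Icc_subset_Ici_self)
      (fun x hx => (hui x hx.1 i).mono (Ici_subset_Ici.2 hx.1)) (by simpa [hu0] using hM i)
      (fun x hx hMx => hbar _ (fun j => (hcM _ j).trans_lt hM0) i (by simp [hc, hMx, hmM]))
  refine ⟨u, hu0, fun t ht i => ⟨(hle t ht i).trans_lt hM0, ?_⟩⟩
  have : c (u t) = u t := funext fun j => min_eq_left (hle t ht j)
  simpa [this] using hui t ht i

/-- The barrier keeps ρ below some M < 0, where the field is bounded. Hence ρ is Lipschitz and has a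
limit at τ with negative coordinates, from which a new solution is started. -/
theorem IsNegSolutionOn.exists_extension (hm : m < 0)
    (hcont : ContinuousOn F {x | ∀ i, x i < 0})
    (hbar : ∀ x : ι → ℝ, (∀ i, x i < 0) → ∀ i, m ≤ x i → F x i ≤ 0)
    (hbdd : ∀ M < 0, ∃ C, ∀ x : ι → ℝ, (∀ i, x i ≤ M) → ∀ i, |F x i| ≤ C)
    {τ : ℝ} (hτ : 0 < τ) {ρ : ℝ → ι → ℝ} (hρ : IsNegSolutionOn F (Ico 0 τ) ρ) :
    ∃ u, EqOn u ρ (Ico 0 τ) ∧ IsNegSolutionOn F (Ici 0) u := by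
  obtain ⟨M, hM0, hmM, hM⟩ := exists_neg_bound hm fun i => (hρ 0 ⟨le_rfl, hτ⟩ i).1
  obtain ⟨C, hC⟩ := hbdd M hM0
  have hle : ∀ t ∈ Ico 0 τ, ∀ i, ρ t i ≤ M := fun t ht i =>
    hρ.le_of_barrier (fun x hx => ⟨hx.1, hx.2.trans_lt ht.2⟩)
      (fun x hx => Filter.mem_of_superset (Ico_mem_nhdsGE (hx.2.trans ht.2))
        (Ico_subset_Ico_left hx.1)) (fun x hx i hi => hbar x hx i (hmM.trans hi)) ht.1 hM i
  have hlip : ∀ i, ∃ g : ℝ → ℝ, Continuous g ∧ EqOn (fun t => ρ t i) g (Ico 0 τ) := fun i => by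
    have : LipschitzOnWith C.toNNReal (fun t => ρ t i) (Ico 0 τ) :=
      (convex_Ico 0 τ).lipschitzOnWith_of_nnnorm_hasDerivWithin_le (fun t ht => (hρ t ht i).2)
        (fun t ht => by
          rw [← NNReal.coe_le_coe, coe_nnnorm, Real.norm_eq_abs]
          exact (hC _ (hle t ht) i).trans (Real.le_coe_toNNReal C))
    obtain ⟨g, hg, hgeq⟩ := this.extend_real
    exact ⟨g, hg.continuous, hgeq⟩
  choose g hg hgeq using hlip
  have hIoo : Ioo 0 τ ∈ 𝓝[<] τ := Ioo_mem_nhdsLT hτ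
  have hρlim : ∀ i, Tendsto (fun t => ρ t i) (𝓝[<] τ) (𝓝 (g i τ)) := fun i => by
    refine Tendsto.congr' ?_ (((hg i).tendsto τ).mono_left nhdsWithin_le_nhds)
    filter_upwards [hIoo] with t ht
    exact (hgeq i (Ioo_subset_Ico_self ht)).symm
  have hgM : ∀ i, g i τ ≤ M := fun i => by
    refine le_of_tendsto (hρlim i) ?_
    filter_upwards [hIoo] with t ht using hle t (Ioo_subset_Ico_self ht) i
  obtain ⟨v, hv0, hv⟩ := exists_isNegSolutionOn_Ici (x₀ := fun i => g i τ) hm hcont hbar hbdd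
    (fun i => (hgM i).trans_lt hM0)
  set u : ℝ → ι → ℝ := fun t => if t < τ then ρ t else v (t - τ) with hu
  have hu1 : ∀ t, t < τ → u t = ρ t := fun t ht => by simp [hu, ht]
  have hu2 : ∀ t, τ ≤ t → u t = v (t - τ) := fun t ht => by simp [hu, ht.not_gt]
  have hright : ∀ t, τ ≤ t → ∀ i, HasDerivWithinAt (fun s => u s i) (F (u t) i) (Ici τ) t :=
    fun t ht i => by
      have h1 := (hv (t - τ) (sub_nonneg.2 ht) i).2
      have h2 : HasDerivWithinAt (fun s => s - τ) 1 (Ici τ) t :=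
        ((hasDerivAt_id t).sub_const τ).hasDerivWithinAt
      have h3 := h1.comp t h2 (fun s hs => sub_nonneg.2 hs)
      rw [mul_one, ← hu2 t ht] at h3
      exact h3.congr (fun s hs => by simp [hu2 s hs]) (by simp [hu2 t ht])
  have hρin : ∀ t ∈ Ioo 0 τ, ∀ i, HasDerivAt (fun s => u s i) (F (ρ t) i) t := fun t ht i => by
    refine ((hρ t (Ioo_subset_Ico_self ht) i).2.hasDerivAt
      (Ico_mem_nhds ht.1 ht.2)).congr_of_eventuallyEq ?_
    filter_upwards [Iio_mem_nhds ht.2] with s hs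
    rw [hu1 s hs]
  have huτ : u τ = fun i => g i τ := by rw [hu2 τ le_rfl, sub_self, hv0]
  refine ⟨u, fun t ht => hu1 t ht.2, fun t ht i => ?_⟩
  rcases lt_trichotomy t τ with htτ | rfl | htτ
  · rw [hu1 t htτ]
    refine ⟨(hρ t ⟨ht, htτ⟩ i).1, ?_⟩
    have : Ico 0 τ ∈ 𝓝[Ici 0] t :=
      inter_mem self_mem_nhdsWithin (mem_nhdsWithin_of_mem_nhds (Iio_mem_nhds htτ))
    refine ((hρ t ⟨ht, htτ⟩ i).2.mono_of_mem_nhdsWithin this).congr_of_eventuallyEq ?_ (by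
      simp [hu1 t htτ])
    filter_upwards [mem_nhdsWithin_of_mem_nhds (Iio_mem_nhds htτ)] with s hs
    rw [hu1 s hs]
  · refine ⟨by rw [huτ]; exact (hgM i).trans_lt hM0, ?_⟩
    -- At the junction the left derivative is the limit of the derivatives of ρ, by continuity of
    -- the field; the right derivative comes from the restarted solution.
    have hl : HasDerivWithinAt (fun s => u s i) (F (u t) i) (Iic t) t := by
      refine hasDerivWithinAt_Iic_of_tendsto_deriv (s := Ioo 0 t)
        (fun s hs => (hρin s hs i).differentiableAt.differentiableWithinAt) ?_ hIoo ?_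
      · have : Tendsto (fun s => u s i) (𝓝[<] t) (𝓝 (u t i)) := by
          rw [huτ]
          refine (hρlim i).congr' ?_
          filter_upwards [self_mem_nhdsWithin] with s hs
          rw [hu1 s hs]
        exact this.mono_left (nhdsWithin_mono _ fun s hs => hs.2)
      · have h1 : Tendsto ρ (𝓝[<] t) (𝓝 (u t)) := by
          rw [huτ]
          exact tendsto_pi_nhds.2 hρlim
        have hopen : IsOpen {x : ι → ℝ | ∀ i, x i < 0} := by
          simp only [ofPred_forall]
          exact isOpen_iInter_of_finite fun i => isOpen_lt (continuous_apply i) continuous_const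
        have h2 : ContinuousAt F (u t) := hcont.continuousAt
          (hopen.mem_nhds (by rw [huτ]; exact fun i => (hgM i).trans_lt hM0))
        refine (((continuous_apply i).tendsto _).comp (h2.tendsto.comp h1)).congr' ?_
        filter_upwards [hIoo] with s hs
        exact (hρin s hs i).deriv.symm
    refine (hl.union (hright t le_rfl i)).mono fun s _ => ?_
    exact le_total s t
  · refine ⟨?_, ?_⟩
    · rw [hu2 t htτ.le]
      exact (hv _ (sub_nonneg.2 htτ.le) i).1
    · exact (hright t htτ.le i).mono_of_mem_nhdsWithin
        (mem_nhdsWithin_of_mem_nhds (Ici_mem_nhds htτ))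

end Flow

end BoundedField

/-! ### Hyperbolic triangles of three circles. -/

namespace HypTriangle

open Real

/-- The determinant `1 + 2xyz - x² - y² - z²`, where `x, y, z` are the hyperbolic cosines of the
sides of a hyperbolic triangle. -/
noncomputable def disc (x y z : ℝ) : ℝ := 1 + 2 * x * y * z - x ^ 2 - y ^ 2 - z ^ 2

/-- The angle between sides with hyperbolic cosines `x` and `y` opposite to one with hyperbolic
cosine `z`. -/
noncomputable def lawAngle (x y z : ℝ) : ℝ :=
  arccos ((x * y - z) / (√(x ^ 2 - 1) * √(y ^ 2 - 1)))

theorem hasDerivAt_lawAngle {x y z : ℝ → ℝ} {x' y' z' t : ℝ} (hx : HasDerivAt x x' t)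
    (hy : HasDerivAt y y' t) (hz : HasDerivAt z z' t) (hx1 : 1 < x t) (hy1 : 1 < y t)
    (hD : 0 < disc (x t) (y t) (z t)) :
    HasDerivAt (fun s => lawAngle (x s) (y s) (z s))
      ((z' - (x t * z t - y t) / (x t ^ 2 - 1) * x' - (y t * z t - x t) / (y t ^ 2 - 1) * y') /
        √(disc (x t) (y t) (z t))) t := by
  have hx2 : 0 < x t ^ 2 - 1 := by nlinarith
  have hy2 : 0 < y t ^ 2 - 1 := by nlinarith
  have hA := (((hx.pow 2).sub_const 1).sqrt hx2.ne')
  have hB := (((hy.pow 2).sub_const 1).sqrt hy2.ne')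
  have hA0 := Real.sqrt_pos.2 hx2
  have hB0 := Real.sqrt_pos.2 hy2
  have hA2 := Real.sq_sqrt hx2.le
  have hB2 := Real.sq_sqrt hy2.le
  have hD0 := Real.sqrt_pos.2 hD
  have hD2 := Real.sq_sqrt hD.le
  have hW := ((hx.mul hy).sub hz).div (hA.mul hB) (mul_pos hA0 hB0).ne'
  simp only [Pi.mul_apply, Pi.sub_apply, Pi.pow_apply] at hW
  -- The sine of the angle is √disc divided by the two hyperbolic sines, so disc > 0 keeps the
  -- arccosine away from ±1.
  have h1W : 1 - ((x t * y t - z t) / (√(x t ^ 2 - 1) * √(y t ^ 2 - 1))) ^ 2 =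
      (√(disc (x t) (y t) (z t)) / (√(x t ^ 2 - 1) * √(y t ^ 2 - 1))) ^ 2 := by
    rw [div_pow, div_pow, mul_pow, hA2, hB2, hD2]
    rw [disc]
    field_simp
    ring
  have hpos : 0 < (√(disc (x t) (y t) (z t)) / (√(x t ^ 2 - 1) * √(y t ^ 2 - 1))) ^ 2 := by
    positivity
  have hne1 : (x t * y t - z t) / (√(x t ^ 2 - 1) * √(y t ^ 2 - 1)) ≠ -1 := fun h => by
    rw [h] at h1W
    linarith
  have hne2 : (x t * y t - z t) / (√(x t ^ 2 - 1) * √(y t ^ 2 - 1)) ≠ 1 := fun h => by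
    rw [h] at h1W
    linarith
  have h := (hasDerivAt_arccos hne1 hne2).comp t hW
  rw [h1W, Real.sqrt_sq (by positivity)] at h
  refine h.congr_deriv ?_
  generalize √(disc (x t) (y t) (z t)) = d at *
  generalize √(x t ^ 2 - 1) = A at *
  generalize √(y t ^ 2 - 1) = B at *
  rw [← hA2, ← hB2]
  field_simp
  ring_nf
  rw [show x t ^ 2 = A ^ 2 + 1 by linarith, show y t ^ 2 = B ^ 2 + 1 by linarith]
  ring

/-- The hyperbolic cosine of the distance of the centres of two circles with radii `a`, `b` and
inversive distance `p`. -/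
noncomputable def coshLen (a b p : ℝ) : ℝ := cosh a * cosh b + sinh a * sinh b * p

theorem coshLen_comm (a b p : ℝ) : coshLen a b p = coshLen b a p := by
  unfold coshLen; ring

/-- The weights (1 ± p) / 2 are nonnegative with sum 1 when |p| ≤ 1. For p > -1 the part with cosh
(a + b) gives all lower bounds on lengths below. -/
theorem coshLen_eq (a b p : ℝ) :
    coshLen a b p = (1 + p) / 2 * cosh (a + b) + (1 - p) / 2 * cosh (a - b) := by
  rw [coshLen, cosh_add, cosh_sub]; ring

theorem hasDerivAt_coshLen_left (a b p : ℝ) :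
    HasDerivAt (fun s => coshLen s b p) (sinh a * cosh b + cosh a * sinh b * p) a := by
  unfold coshLen
  exact ((hasDerivAt_cosh a).mul_const _).add (((hasDerivAt_sinh a).mul_const _).mul_const _)

theorem hasDerivAt_coshLen_right (a b p : ℝ) :
    HasDerivAt (fun s => coshLen a s p) (sinh b * cosh a + cosh b * sinh a * p) b := by
  simpa only [coshLen_comm a] using hasDerivAt_coshLen_left b a p

section

variable {a b p : ℝ}

theorem coshLen_sub_one_ge (hp1 : p ≤ 1) :
    (1 + p) / 2 * (cosh (a + b) - 1) ≤ coshLen a b p - 1 := by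
  rw [coshLen_eq]
  nlinarith [one_le_cosh (a - b)]

theorem coshLen_sub_one_ge_cosh (ha : 0 < a) (hb : 0 < b) (hp : -1 < p) (hp1 : p ≤ 1) :
    (1 + p) / 2 * (cosh a - 1) ≤ coshLen a b p - 1 := by
  refine le_trans ?_ (coshLen_sub_one_ge hp1)
  have : cosh a ≤ cosh (a + b) := by
    rw [cosh_le_cosh, abs_of_pos ha, abs_of_pos (by positivity)]
    linarith
  nlinarith

theorem one_lt_coshLen (ha : 0 < a) (hb : 0 < b) (hp : -1 < p) (hp1 : p ≤ 1) :
    1 < coshLen a b p := by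
  have h1 := coshLen_sub_one_ge_cosh ha hb hp hp1
  have h2 : 1 < cosh a := one_lt_cosh.2 ha.ne'
  nlinarith

theorem coshLen_le (ha : 0 < a) (hb : 0 < b) (hp1 : p ≤ 1) :
    coshLen a b p ≤ 2 * (cosh a * cosh b) := by
  have h1 := sinh_pos_iff.2 ha
  have h2 := sinh_pos_iff.2 hb
  have h3 := sinh_lt_cosh a
  have h4 := sinh_lt_cosh b
  have h5 : sinh a * sinh b ≤ cosh a * cosh b := mul_le_mul h3.le h4.le h2.le (cosh_pos a).le
  have h6 := mul_pos h1 h2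
  unfold coshLen
  nlinarith

theorem sq_mul_sinh_add_sq_le (hp : -1 < p) (hp1 : p ≤ 1) :
    ((1 + p) / 2) ^ 2 * sinh (a + b) ^ 2 ≤ coshLen a b p ^ 2 - 1 := by
  have h1 := coshLen_sub_one_ge (a := a) (b := b) hp1
  have h2 : (1 + p) / 2 * (cosh (a + b) + 1) ≤ coshLen a b p + 1 := by
    rw [coshLen_eq]
    nlinarith [one_le_cosh (a - b)]
  have h3 : 0 ≤ (1 + p) / 2 * (cosh (a + b) - 1) :=
    mul_nonneg (by linarith) (by linarith [one_le_cosh (a + b)])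
  have h4 : 0 ≤ (1 + p) / 2 * (cosh (a + b) + 1) :=
    mul_nonneg (by linarith) (by linarith [one_le_cosh (a + b)])
  have h5 := mul_le_mul h1 h2 h4 (h3.trans h1)
  have h6 := cosh_sq (a + b)
  nlinarith

theorem sinh_add_sinh_le (ha : 0 < a) (hb : 0 < b) : sinh a + sinh b ≤ sinh (a + b) := by
  have h1 := sinh_pos_iff.2 ha
  have h2 := sinh_pos_iff.2 hb
  rw [sinh_add]
  nlinarith [one_le_cosh a, one_le_cosh b]

theorem sinh_mul_cosh_le (hb : 0 < b) : sinh a * cosh b ≤ sinh (a + b) := by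
  have h2 := sinh_pos_iff.2 hb
  rw [sinh_add]
  nlinarith [cosh_pos a]

theorem mul_sinh_mul_cosh_le_sqrt (ha : 0 < a) (hb : 0 < b) (hp : -1 < p) (hp1 : p ≤ 1) :
    (1 + p) / 2 * (sinh a * cosh b) ≤ √(coshLen a b p ^ 2 - 1) := by
  refine Real.le_sqrt_of_sq_le (le_trans ?_ (sq_mul_sinh_add_sq_le hp hp1))
  rw [mul_pow]
  have := sinh_mul_cosh_le (a := a) hb
  have h0 : 0 ≤ sinh a * cosh b := mul_nonneg (sinh_pos_iff.2 ha).le (cosh_pos b).le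
  gcongr

end

/-! ### Derivatives of the angles and their signs. -/

/-- The conditions on the cosines of the weights of the sides of a triangle. -/
structure IsAdmissible (p q r : ℝ) : Prop where
  hp : -1 < p
  hp1 : p ≤ 1
  hq : -1 < q
  hq1 : q ≤ 1
  hr : -1 < r
  hr1 : r ≤ 1
  hpqr : 0 ≤ p + q * r
  hqpr : 0 ≤ q + p * r
  hrpq : 0 ≤ r + p * q

theorem IsAdmissible.swap₁₂ {p q r : ℝ} (h : IsAdmissible p q r) : IsAdmissible p r q :=
  ⟨h.hp, h.hp1, h.hr, h.hr1, h.hq, h.hq1, by linarith [h.hpqr, mul_comm q r], h.hrpq, h.hqpr⟩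

theorem IsAdmissible.swap₂₃ {p q r : ℝ} (h : IsAdmissible p q r) : IsAdmissible q p r :=
  ⟨h.hq, h.hq1, h.hp, h.hp1, h.hr, h.hr1, h.hqpr, h.hpqr, by linarith [h.hrpq, mul_comm p q]⟩

/-- The determinant `disc` for circles with radii `a`, `b`, `c` and inversive distances `p`
(of the first two), `q` (of the first and the third) and `r`. -/
noncomputable def circleDisc (a b c p q r : ℝ) : ℝ :=
  disc (coshLen a b p) (coshLen a c q) (coshLen b c r)

/-- The derivative of the angle at the centre of the first circle with respect to the
`u`-coordinate of the second one. -/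
noncomputable def weight (a b c p q r : ℝ) : ℝ :=
  (cosh c * (sinh a ^ 2 * sinh b ^ 2 * (1 - p ^ 2)) +
      cosh a * (sinh a * sinh b ^ 2 * sinh c * (q + p * r)) +
      cosh b * (sinh b * sinh a ^ 2 * sinh c * (r + p * q))) /
    (√(circleDisc a b c p q r) * (coshLen a b p ^ 2 - 1))

theorem circleDisc_swap₁₂ (a b c p q r : ℝ) : circleDisc b a c p r q = circleDisc a b c p q r := by
  simp only [circleDisc, disc, coshLen]; ring

theorem circleDisc_swap₂₃ (a b c p q r : ℝ) : circleDisc a c b q p r = circleDisc a b c p q r := by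
  simp only [circleDisc, disc, coshLen]; ring

/-- This is the symmetry ∂θ_i/∂u_j = ∂θ_j/∂u_i, visible from the symmetric numerator of `weight`. -/
theorem weight_swap₁₂ (a b c p q r : ℝ) : weight b a c p r q = weight a b c p q r := by
  rw [weight, weight, circleDisc_swap₁₂, coshLen_comm b a]
  ring

/-- Under admissibility every summand is nonnegative and the first is positive. So the triangle is
nondegenerate, and each summand by itself is a lower bound for the determinant. -/
theorem circleDisc_eq (a b c p q r : ℝ) :
    circleDisc a b c p q r = 2 * (sinh a ^ 2 * sinh b ^ 2 * sinh c ^ 2 * (1 + p * q * r)) +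
      sinh a ^ 2 * sinh b ^ 2 * (1 - p ^ 2) + sinh a ^ 2 * sinh c ^ 2 * (1 - q ^ 2) +
      sinh b ^ 2 * sinh c ^ 2 * (1 - r ^ 2) +
      2 * (cosh b * cosh c * (sinh a ^ 2 * sinh b * sinh c * (r + p * q))) +
      2 * (cosh a * cosh c * (sinh a * sinh b ^ 2 * sinh c * (q + p * r))) +
      2 * (cosh a * cosh b * (sinh a * sinh b * sinh c ^ 2 * (p + q * r))) := by
  have h1 := cosh_sq a
  have h2 := cosh_sq b
  have h3 := cosh_sq c
  simp only [circleDisc, disc, coshLen]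
  grind

theorem one_sub_sq_nonneg {p : ℝ} (hp : -1 < p) (hp1 : p ≤ 1) : 0 ≤ 1 - p ^ 2 := by nlinarith

section

variable {a b c p q r : ℝ}

theorem IsAdmissible.one_add_pos (h : IsAdmissible p q r) : 0 < 1 + p * q * r := by
  obtain ⟨hp, hp1, hq, hq1, hr, hr1, hpqr, hqpr, hrpq⟩ := h
  rcases le_total 0 (p * q) with hpq | hpq
  · have h1 : p * q ≤ 1 := by nlinarith
    nlinarith
  · have h1 : -1 < p * q := by
      rcases le_total 0 p with h0 | h0 <;> nlinarith
    have h2 : p * q * r ≥ p * q := by nlinarith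
    linarith

theorem circleDisc_bounds (h : IsAdmissible p q r) (ha : 0 < a) (hb : 0 < b) (hc : 0 < c) :
    0 < circleDisc a b c p q r ∧
    sinh a ^ 2 * sinh b ^ 2 * (1 - p ^ 2) ≤ circleDisc a b c p q r ∧
    sinh b ^ 2 * sinh c ^ 2 * (1 - r ^ 2) ≤ circleDisc a b c p q r ∧
    2 * (cosh a * cosh b * (sinh a * sinh b * sinh c ^ 2 * (p + q * r))) ≤
      circleDisc a b c p q r := by
  have h0 := h.one_add_pos
  obtain ⟨hp, hp1, hq, hq1, hr, hr1, hpqr, hqpr, hrpq⟩ := h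
  have sa := sinh_pos_iff.2 ha
  have sb := sinh_pos_iff.2 hb
  have sc := sinh_pos_iff.2 hc
  have ca := cosh_pos a
  have cb := cosh_pos b
  have cc := cosh_pos c
  have t0 : 0 < sinh a ^ 2 * sinh b ^ 2 * sinh c ^ 2 * (1 + p * q * r) := by positivity
  have t1 := mul_nonneg (show 0 ≤ sinh a ^ 2 * sinh b ^ 2 by positivity) (one_sub_sq_nonneg hp hp1)
  have t2 := mul_nonneg (show 0 ≤ sinh a ^ 2 * sinh c ^ 2 by positivity) (one_sub_sq_nonneg hq hq1)
  have t3 := mul_nonneg (show 0 ≤ sinh b ^ 2 * sinh c ^ 2 by positivity) (one_sub_sq_nonneg hr hr1)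
  have t4 : 0 ≤ cosh b * cosh c * (sinh a ^ 2 * sinh b * sinh c * (r + p * q)) := by positivity
  have t5 : 0 ≤ cosh a * cosh c * (sinh a * sinh b ^ 2 * sinh c * (q + p * r)) := by positivity
  have t6 : 0 ≤ cosh a * cosh b * (sinh a * sinh b * sinh c ^ 2 * (p + q * r)) := by positivity
  rw [circleDisc_eq]
  refine ⟨?_, ?_, ?_, ?_⟩ <;> linarith

theorem circleDisc_pos (h : IsAdmissible p q r) (ha : 0 < a) (hb : 0 < b) (hc : 0 < c) :
    0 < circleDisc a b c p q r := (circleDisc_bounds h ha hb hc).1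

theorem weight_nonneg (h : IsAdmissible p q r) (ha : 0 < a) (hb : 0 < b) (hc : 0 < c) :
    0 ≤ weight a b c p q r := by
  have hx := one_lt_coshLen ha hb h.hp h.hp1
  obtain ⟨hp, hp1, hq, hq1, hr, hr1, hpqr, hqpr, hrpq⟩ := h
  have sa := sinh_pos_iff.2 ha
  have sb := sinh_pos_iff.2 hb
  have sc := sinh_pos_iff.2 hc
  have ca := cosh_pos a
  have cb := cosh_pos b
  have cc := cosh_pos c
  have h1 := one_sub_sq_nonneg hp hp1
  refine div_nonneg (by positivity) (mul_nonneg (Real.sqrt_nonneg _) (by nlinarith))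

/-! ### Bound on the weights, uniform as radii tend to 0. -/

theorem le_mul_sqrt_mul_sq {T K D w : ℝ} (hK : 0 ≤ K) (hT : T ^ 2 ≤ K * D * w ^ 4) :
    T ≤ √K * √D * w ^ 2 := by
  have h1 := Real.le_sqrt_of_sq_le hT
  rwa [show K * D * w ^ 4 = K * D * (w ^ 2) ^ 2 by ring, Real.sqrt_mul' _ (by positivity),
    Real.sqrt_mul hK, Real.sqrt_sq (by positivity)] at h1

/-- The denominator of `weight` is at least a constant times √D (sinh a + sinh b)², so each of the
three terms of the numerator is to be bounded by such a product. After squaring, this one follows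
because the term is itself a summand of D. -/
theorem exists_bound_first (p q r : ℝ) (h : IsAdmissible p q r) : ∃ C, 0 ≤ C ∧
    ∀ a b c : ℝ, 0 < a → 0 < b → 0 < c → sinh a ^ 2 * sinh b ^ 2 * (1 - p ^ 2) ≤
      C * √(circleDisc a b c p q r) * (sinh a + sinh b) ^ 2 := by
  refine ⟨√1, Real.sqrt_nonneg _, fun a b c ha hb hc => le_mul_sqrt_mul_sq zero_le_one ?_⟩
  obtain ⟨hD, h1, -, -⟩ := circleDisc_bounds h ha hb hc
  have sa := sinh_pos_iff.2 ha
  have sb := sinh_pos_iff.2 hb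
  have h2 := one_sub_sq_nonneg h.hp h.hp1
  have h3 : sinh a ^ 2 * sinh b ^ 2 * (1 - p ^ 2) ≤ (sinh a + sinh b) ^ 4 := by
    have e1 : sinh a ^ 2 * sinh b ^ 2 * (1 - p ^ 2) ≤ sinh a ^ 2 * sinh b ^ 2 * 1 := by
      gcongr
      nlinarith [sq_nonneg p]
    have e2 : sinh a ^ 2 * sinh b ^ 2 ≤ (sinh a + sinh b) ^ 2 * (sinh a + sinh b) ^ 2 := by
      gcongr <;> linarith
    nlinarith
  have := mul_le_mul h1 h3 (by positivity) hD.le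
  nlinarith

theorem exists_bound_second (p q r : ℝ) (h : IsAdmissible p q r) : ∃ C, 0 ≤ C ∧
    ∀ a b c : ℝ, 0 < a → 0 < b → 0 < c → sinh a * sinh b ^ 2 * sinh c * (q + p * r) ≤
      C * √(circleDisc a b c p q r) * (sinh a + sinh b) ^ 2 := by
  have hγ : q + p * r ≤ 2 := by nlinarith [h.hp, h.hp1, h.hr, h.hr1, h.hq1]
  have hγ0 := h.hqpr
  rcases h.hr1.lt_or_eq with hr | hr
  -- For r < 1 the summand of D with 1 - r² controls sinh b sinh c; the 4 bounds (q + p r)².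
  · have hr2 : 0 < 1 - r ^ 2 := by nlinarith [h.hr]
    refine ⟨√(4 / (1 - r ^ 2)), Real.sqrt_nonneg _, fun a b c ha hb hc =>
      le_mul_sqrt_mul_sq (by positivity) ?_⟩
    obtain ⟨hD, -, h1, -⟩ := circleDisc_bounds h ha hb hc
    have sa := sinh_pos_iff.2 ha
    have sb := sinh_pos_iff.2 hb
    have sc := sinh_pos_iff.2 hc
    have e2 : sinh a ^ 2 * sinh b ^ 2 ≤ (sinh a + sinh b) ^ 2 * (sinh a + sinh b) ^ 2 := by
      gcongr <;> linarith
    have e3 : (q + p * r) ^ 2 ≤ 4 := by nlinarith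
    calc (sinh a * sinh b ^ 2 * sinh c * (q + p * r)) ^ 2
        = (q + p * r) ^ 2 / (1 - r ^ 2) * (sinh b ^ 2 * sinh c ^ 2 * (1 - r ^ 2)) *
            (sinh a ^ 2 * sinh b ^ 2) := by
          field_simp
      _ ≤ 4 / (1 - r ^ 2) * circleDisc a b c p q r *
            ((sinh a + sinh b) ^ 2 * (sinh a + sinh b) ^ 2) := by
          gcongr
      _ = _ := by ring
  -- For r = 1 that summand vanishes, but q + p r = p + q r, so the summand of D with the factor p +
  -- q r takes its place.
  · refine ⟨√1, Real.sqrt_nonneg _, fun a b c ha hb hc => le_mul_sqrt_mul_sq zero_le_one ?_⟩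
    obtain ⟨hD, -, -, h1⟩ := circleDisc_bounds h ha hb hc
    have sa := sinh_pos_iff.2 ha
    have sb := sinh_pos_iff.2 hb
    have sc := sinh_pos_iff.2 hc
    have ca := one_le_cosh a
    have cb := one_le_cosh b
    subst hr
    have e1 : sinh a * sinh b * sinh c ^ 2 * (q + p * 1) * 2 ≤ circleDisc a b c p q 1 := by
      refine le_trans ?_ h1
      have : 0 ≤ sinh a * sinh b * sinh c ^ 2 * (q + p * 1) := by positivity
      rw [show p + q * 1 = q + p * 1 by ring]
      nlinarith [mul_le_mul ca cb zero_le_one (cosh_pos a).le]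
    have e2 : sinh a * sinh b ^ 3 ≤ (sinh a + sinh b) * (sinh a + sinh b) ^ 3 := by
      gcongr <;> linarith
    calc (sinh a * sinh b ^ 2 * sinh c * (q + p * 1)) ^ 2
        = (q + p * 1) / 2 * (sinh a * sinh b * sinh c ^ 2 * (q + p * 1) * 2) *
            (sinh a * sinh b ^ 3) := by ring
      _ ≤ 1 * circleDisc a b c p q 1 * ((sinh a + sinh b) * (sinh a + sinh b) ^ 3) := by
          gcongr
          linarith
      _ = _ := by ring

/-- The third term of the numerator is the second one with the first two circles exchanged. The
constant depends only on p, q, r, so no lower bound on the radii is needed. -/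
theorem exists_weight_bound (h : IsAdmissible p q r) : ∃ C, 0 ≤ C ∧
    ∀ a b c : ℝ, 0 < a → 0 < b → 0 < c →
      weight a b c p q r ≤ C * (cosh a + cosh b + cosh c) := by
  obtain ⟨C₁, hC₁, h₁⟩ := exists_bound_first p q r h
  obtain ⟨C₂, hC₂, h₂⟩ := exists_bound_second p q r h
  obtain ⟨C₃, hC₃, h₃⟩ := exists_bound_second p r q h.swap₁₂
  have hp := h.hp
  have hk : 0 < (1 + p) / 2 := by linarith
  refine ⟨(C₁ + C₂ + C₃) / ((1 + p) / 2) ^ 2, by positivity, fun a b c ha hb hc => ?_⟩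
  have hD := Real.sqrt_pos.2 (circleDisc_pos h ha hb hc)
  have sa := sinh_pos_iff.2 ha
  have sb := sinh_pos_iff.2 hb
  have ca := cosh_pos a
  have cb := cosh_pos b
  have cc := cosh_pos c
  have g₁ := h₁ a b c ha hb hc
  have g₂ := h₂ a b c ha hb hc
  have g₃ := h₃ b a c hb ha hc
  rw [circleDisc_swap₁₂, add_comm (sinh b)] at g₃
  have hx : ((1 + p) / 2) ^ 2 * (sinh a + sinh b) ^ 2 ≤ coshLen a b p ^ 2 - 1 := by
    refine le_trans ?_ (sq_mul_sinh_add_sq_le hp h.hp1)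
    have := sinh_add_sinh_le ha hb
    gcongr
  have hx1 := one_lt_coshLen ha hb hp h.hp1
  rw [weight, div_le_iff₀ (mul_pos hD (by nlinarith))]
  set D := √(circleDisc a b c p q r)
  set w := (sinh a + sinh b) ^ 2
  have hw : 0 < w := by positivity
  have e1 : ∀ x y : ℝ, 0 < x → x ≤ cosh a + cosh b + cosh c → ∀ C, 0 ≤ C → y ≤ C * D * w →
      x * y ≤ (cosh a + cosh b + cosh c) * (C * D * w) := fun x y hx hxs C hC hy =>
    (mul_le_mul_of_nonneg_left hy hx.le).trans (mul_le_mul_of_nonneg_right hxs (by positivity))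
  have f1 := e1 _ _ cc (by linarith) C₁ hC₁ g₁
  have f2 := e1 _ _ ca (by linarith) C₂ hC₂ g₂
  have f3 := e1 _ _ cb (by linarith) C₃ hC₃ g₃
  calc _ ≤ (cosh a + cosh b + cosh c) * ((C₁ + C₂ + C₃) * D * w) := by linarith
    _ = (C₁ + C₂ + C₃) / ((1 + p) / 2) ^ 2 * (cosh a + cosh b + cosh c) *
          (D * (((1 + p) / 2) ^ 2 * w)) := by
        have : 1 + p ≠ 0 := by linarith
        field_simp
    _ ≤ _ := by gcongr

theorem weight_mul_eq (h : IsAdmissible p q r) (ha : 0 < a) (hb : 0 < b) (hc : 0 < c) :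
    weight a b c p q r = sinh b * (((sinh b * cosh c + cosh b * sinh c * r) -
      (coshLen a b p * coshLen b c r - coshLen a c q) / (coshLen a b p ^ 2 - 1) *
        (sinh b * cosh a + cosh b * sinh a * p)) / √(circleDisc a b c p q r)) := by
  have hD := Real.sqrt_pos.2 (circleDisc_pos h ha hb hc)
  have hx1 := one_lt_coshLen ha hb h.hp h.hp1
  have hx2 : coshLen a b p ^ 2 - 1 ≠ 0 := by nlinarith
  have h1 := cosh_sq a
  have h2 := cosh_sq b
  have h3 := cosh_sq c
  rw [weight]
  field_simp
  unfold coshLen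
  grind

theorem hasDerivAt_lawAngle_other (h : IsAdmissible p q r) (ha : 0 < a) (hb : 0 < b) (hc : 0 < c) :
    HasDerivAt (fun s => lawAngle (coshLen a s p) (coshLen a c q) (coshLen s c r))
      (weight a b c p q r / sinh b) b := by
  have sb := sinh_pos_iff.2 hb
  have := hasDerivAt_lawAngle (hasDerivAt_coshLen_right a b p)
    (hasDerivAt_const b (coshLen a c q)) (hasDerivAt_coshLen_left b c r)
    (one_lt_coshLen ha hb h.hp h.hp1) (one_lt_coshLen ha hc h.hq h.hq1) (circleDisc_pos h ha hb hc)
  refine this.congr_deriv ?_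
  rw [weight_mul_eq h ha hb hc, mul_div_cancel_left₀ _ sb.ne', mul_zero, sub_zero]
  rfl

/-- In the u-coordinates this is ∂θ_i/∂u_i = -∑_j cosh l_ij ∂θ_i/∂u_j, which reduces all derivatives
to `weight`. -/
theorem hasDerivAt_lawAngle_self (h : IsAdmissible p q r) (ha : 0 < a) (hb : 0 < b) (hc : 0 < c) :
    HasDerivAt (fun s => lawAngle (coshLen s b p) (coshLen s c q) (coshLen b c r))
      (-(coshLen a b p * weight a b c p q r + coshLen a c q * weight a c b q p r) / sinh a) a := by
  have sa := sinh_pos_iff.2 ha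
  have hx1 := one_lt_coshLen ha hb h.hp h.hp1
  have hy1 := one_lt_coshLen ha hc h.hq h.hq1
  have hD := circleDisc_pos h ha hb hc
  have := hasDerivAt_lawAngle (hasDerivAt_coshLen_left a b p) (hasDerivAt_coshLen_left a c q)
    (hasDerivAt_const a (coshLen b c r)) hx1 hy1 hD
  refine this.congr_deriv ?_
  -- By symmetry both weights become derivatives with respect to the first radius. Then only the
  -- derivatives of x and y in a occur, and a rational identity in x, y, z remains.
  rw [← weight_swap₁₂ a b, ← weight_swap₁₂ a c, weight_mul_eq h.swap₁₂ hb ha hc,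
    weight_mul_eq h.swap₂₃.swap₁₂ hc ha hb, circleDisc_swap₁₂ a b c p q r,
    circleDisc_swap₁₂ a c b q p r, circleDisc_swap₂₃ a b c p q r, coshLen_comm b a, coshLen_comm c a, coshLen_comm c b]
  rw [show disc (coshLen a b p) (coshLen a c q) (coshLen b c r) = circleDisc a b c p q r from rfl]
  have hD0 := Real.sqrt_pos.2 hD
  have hx2 : coshLen a b p ^ 2 - 1 ≠ 0 := by nlinarith
  have hy2 : coshLen a c q ^ 2 - 1 ≠ 0 := by nlinarith
  generalize √(circleDisc a b c p q r) = d at *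
  generalize coshLen a b p = x at *
  generalize coshLen a c q = y at *
  generalize coshLen b c r = z at *
  field_simp
  ring

/-- Since A B ≤ x y, the cosine is at least 1 - z / (A B). Here z ≤ 2 cosh b cosh c, and A B is at
least (1 + p)(1 + q) / 4 times sinh² a cosh b cosh c, so b and c cancel. The angle is thus small for
large a, uniformly in b and c. -/
theorem one_sub_cos_le (h : IsAdmissible p q r) (ha : 0 < a) (hb : 0 < b) (hc : 0 < c) :
    1 - 8 / ((1 + p) * (1 + q) * sinh a ^ 2) ≤
      (coshLen a b p * coshLen a c q - coshLen b c r) /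
        (√(coshLen a b p ^ 2 - 1) * √(coshLen a c q ^ 2 - 1)) := by
  have hp := h.hp
  have hq := h.hq
  have sa := sinh_pos_iff.2 ha
  have cb := cosh_pos b
  have cc := cosh_pos c
  have hx1 := one_lt_coshLen ha hb h.hp h.hp1
  have hy1 := one_lt_coshLen ha hc h.hq h.hq1
  have hA := mul_sinh_mul_cosh_le_sqrt ha hb h.hp h.hp1
  have hB := mul_sinh_mul_cosh_le_sqrt ha hc h.hq h.hq1
  have hz := coshLen_le hb hc h.hr1
  have hA2 := Real.sq_sqrt (show 0 ≤ coshLen a b p ^ 2 - 1 by nlinarith)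
  have hB2 := Real.sq_sqrt (show 0 ≤ coshLen a c q ^ 2 - 1 by nlinarith)
  have hp' : 0 < 1 + p := by linarith
  have hq' : 0 < 1 + q := by linarith
  have hA0 : 0 < √(coshLen a b p ^ 2 - 1) := lt_of_lt_of_le (by positivity) hA
  have hB0 : 0 < √(coshLen a c q ^ 2 - 1) := lt_of_lt_of_le (by positivity) hB
  have hAB := mul_le_mul hA hB (by positivity) hA0.le
  generalize √(coshLen a b p ^ 2 - 1) = A at *
  generalize √(coshLen a c q ^ 2 - 1) = B at *
  generalize coshLen a b p = x at *
  generalize coshLen a c q = y at *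
  have hxy : A * B ≤ x * y := by
    have : A ≤ x := by nlinarith
    have : B ≤ y := by nlinarith
    gcongr
  rw [le_div_iff₀ (by positivity)]
  have : 2 * (cosh b * cosh c) ≤ 8 / ((1 + p) * (1 + q) * sinh a ^ 2) * (A * B) := by
    calc 2 * (cosh b * cosh c) = 8 / ((1 + p) * (1 + q) * sinh a ^ 2) *
        ((1 + p) / 2 * (sinh a * cosh b) * ((1 + q) / 2 * (sinh a * cosh c))) := by
          field_simp; ring
      _ ≤ _ := by gcongr
  nlinarith

end

end HypTriangle

/-! ### Angles and areas of the faces of a triangulation. -/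

namespace CirclePacking

open Real HypTriangle Filter

variable {V : Type*} [DecidableEq V]

/-- The hyperbolic cosine of the length of the edge between `i` and `j`. -/
noncomputable def coshEdge (Φ : Finset V → ℝ) (r : V → ℝ) (i j : V) : ℝ :=
  coshLen (r i) (r j) (cos (Φ {i, j}))

/-- A set of three vertices such that the cosines of the weights of its sides are admissible. -/
def IsGoodFace (Φ : Finset V → ℝ) (σ : Finset V) : Prop :=
  ∀ i ∈ σ, ∀ j ∈ σ.erase i, ∃ k, i ≠ j ∧ i ≠ k ∧ j ≠ k ∧ σ = {i, j, k} ∧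
    IsAdmissible (cos (Φ {i, j})) (cos (Φ {i, k})) (cos (Φ {j, k}))

/-- `∂θ_i/∂u_j` in the face `σ`. -/
noncomputable def faceWeight (Φ : Finset V → ℝ) (r : V → ℝ) (σ : Finset V) (i j : V) : ℝ :=
  partialU (fun s => angle Φ s σ i) r j

variable {Φ : Finset V → ℝ} {r : V → ℝ} {σ : Finset V} {i j k : V}

theorem edgeLength_pair (hij : i ≠ j) : edgeLength Φ r {i, j} = arcosh (coshEdge Φ r i j) := by
  rw [edgeLength, prod_pair hij, prod_pair hij]
  rfl

theorem angle_eq (hr : ∀ i, 0 < r i) (hij : i ≠ j) (hik : i ≠ k) (hjk : j ≠ k)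
    (h : IsAdmissible (cos (Φ {i, j})) (cos (Φ {i, k})) (cos (Φ {j, k}))) :
    angle Φ r {i, j, k} i =
      lawAngle (coshEdge Φ r i j) (coshEdge Φ r i k) (coshEdge Φ r j k) := by
  have h1 : 1 ≤ coshEdge Φ r i j := (one_lt_coshLen (hr i) (hr j) h.hp h.hp1).le
  have h2 : 1 ≤ coshEdge Φ r i k := (one_lt_coshLen (hr i) (hr k) h.hq h.hq1).le
  have h3 : 1 ≤ coshEdge Φ r j k := (one_lt_coshLen (hr j) (hr k) h.hr h.hr1).le
  have he : ({i, j, k} : Finset V).erase i = {j, k} := erase_insert (by simp [hij, hik])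
  rw [angle, he, prod_pair hjk, prod_pair hjk, edgeLength_pair hij, edgeLength_pair hik,
    edgeLength_pair hjk, cosh_arcosh h1, cosh_arcosh h2, cosh_arcosh h3, sinh_arcosh h1,
    sinh_arcosh h2, lawAngle]

theorem angle_congr {r' : V → ℝ} (h : ∀ v ∈ σ, r v = r' v) (hi : i ∈ σ) :
    angle Φ r σ i = angle Φ r' σ i := by
  have he : ∀ e ⊆ σ, edgeLength Φ r e = edgeLength Φ r' e := fun e he => by
    rw [edgeLength, edgeLength, prod_congr rfl fun v hv => by rw [h v (he hv)],
      prod_congr (f := fun v => sinh (r v)) rfl fun v hv => by rw [h v (he hv)]]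
  have hp : ∀ j ∈ σ.erase i, edgeLength Φ r {i, j} = edgeLength Φ r' {i, j} := fun j hj =>
    he _ (by simp [insert_subset_iff, hi, mem_of_mem_erase hj])
  rw [angle, angle, he _ (erase_subset _ _), prod_congr rfl fun j hj => by rw [hp j hj],
    prod_congr (f := fun j => sinh (edgeLength Φ r {i, j})) rfl fun j hj => by rw [hp j hj]]

theorem update_pos (hr : ∀ i, 0 < r i) (m : V) {s : ℝ} (hs : 0 < s) (i : V) :
    0 < Function.update r m s i := by
  rcases eq_or_ne i m with rfl | h
  · simpa using hs
  · simpa [h] using hr i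

theorem hasDerivAt_angle_other (hr : ∀ i, 0 < r i) (hij : i ≠ j) (hik : i ≠ k) (hjk : j ≠ k)
    (h : IsAdmissible (cos (Φ {i, j})) (cos (Φ {i, k})) (cos (Φ {j, k}))) :
    HasDerivAt (fun s => angle Φ (Function.update r j s) {i, j, k} i)
      (weight (r i) (r j) (r k) (cos (Φ {i, j})) (cos (Φ {i, k})) (cos (Φ {j, k})) / sinh (r j))
      (r j) := by
  refine (hasDerivAt_lawAngle_other h (hr i) (hr j) (hr k)).congr_of_eventuallyEq ?_
  filter_upwards [lt_mem_nhds (hr j)] with s hs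
  rw [angle_eq (update_pos hr j hs) hij hik hjk h]
  simp [coshEdge, hij, hjk.symm]

theorem hasDerivAt_angle_self (hr : ∀ i, 0 < r i) (hij : i ≠ j) (hik : i ≠ k) (hjk : j ≠ k)
    (h : IsAdmissible (cos (Φ {i, j})) (cos (Φ {i, k})) (cos (Φ {j, k}))) :
    HasDerivAt (fun s => angle Φ (Function.update r i s) {i, j, k} i)
      (-(coshEdge Φ r i j *
          weight (r i) (r j) (r k) (cos (Φ {i, j})) (cos (Φ {i, k})) (cos (Φ {j, k})) +
        coshEdge Φ r i k *
          weight (r i) (r k) (r j) (cos (Φ {i, k})) (cos (Φ {i, j})) (cos (Φ {j, k}))) /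
        sinh (r i)) (r i) := by
  refine (hasDerivAt_lawAngle_self h (hr i) (hr j) (hr k)).congr_of_eventuallyEq ?_
  filter_upwards [lt_mem_nhds (hr i)] with s hs
  rw [angle_eq (update_pos hr i hs) hij hik hjk h]
  simp [coshEdge, hij.symm, hik.symm]

theorem partialU_eq_of_hasDerivAt {f : (V → ℝ) → ℝ} {d : ℝ} (hr : 0 < r j)
    (h : HasDerivAt (fun s => f (Function.update r j s)) (d / sinh (r j)) (r j)) :
    partialU f r j = d := by
  rw [partialU, h.deriv, mul_div_cancel₀ _ (sinh_pos_iff.2 hr).ne']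

theorem faceWeight_eq (hr : ∀ i, 0 < r i) (hij : i ≠ j) (hik : i ≠ k) (hjk : j ≠ k)
    (h : IsAdmissible (cos (Φ {i, j})) (cos (Φ {i, k})) (cos (Φ {j, k}))) :
    faceWeight Φ r {i, j, k} i j =
      weight (r i) (r j) (r k) (cos (Φ {i, j})) (cos (Φ {i, k})) (cos (Φ {j, k})) :=
  partialU_eq_of_hasDerivAt (hr j) (hasDerivAt_angle_other hr hij hik hjk h)

namespace IsGoodFace

theorem faceWeight_nonneg (hσ : IsGoodFace Φ σ) (hr : ∀ i, 0 < r i) (hi : i ∈ σ)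
    (hj : j ∈ σ.erase i) : 0 ≤ faceWeight Φ r σ i j := by
  obtain ⟨k, hij, hik, hjk, rfl, h⟩ := hσ i hi j hj
  rw [faceWeight_eq hr hij hik hjk h]
  exact weight_nonneg h (hr i) (hr j) (hr k)

theorem exists_faceWeight_bound (hσ : IsGoodFace Φ σ) (hi : i ∈ σ) (hj : j ∈ σ.erase i) (R : ℝ) :
    ∃ C, ∀ r : V → ℝ, (∀ i, 0 < r i ∧ r i ≤ R) → |faceWeight Φ r σ i j| ≤ C := by
  obtain ⟨k, hij, hik, hjk, hs, h⟩ := hσ i hi j hj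
  obtain ⟨C, hC0, hC⟩ := exists_weight_bound h
  refine ⟨C * (cosh R + cosh R + cosh R), fun r hr => ?_⟩
  have hr0 : ∀ i, 0 < r i := fun i => (hr i).1
  have hc : ∀ i, cosh (r i) ≤ cosh R := fun i => by
    rw [cosh_le_cosh, abs_of_pos (hr0 i), abs_of_pos ((hr0 i).trans_le (hr i).2)]
    exact (hr i).2
  rw [abs_of_nonneg (hσ.faceWeight_nonneg hr0 hi hj), hs, faceWeight_eq hr0 hij hik hjk h]
  refine (hC _ _ _ (hr0 i) (hr0 j) (hr0 k)).trans ?_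
  gcongr <;> exact hc _

theorem continuousOn_faceWeight (hσ : IsGoodFace Φ σ) (hi : i ∈ σ) (hj : j ∈ σ.erase i) :
    ContinuousOn (fun r => faceWeight Φ r σ i j) {r | ∀ i, 0 < r i} := by
  obtain ⟨k, hij, hik, hjk, rfl, h⟩ := hσ i hi j hj
  refine ContinuousOn.congr ?_ fun r hr => faceWeight_eq hr hij hik hjk h
  unfold weight
  refine ContinuousOn.div (Continuous.continuousOn (by fun_prop)) ?_ fun r hr => ?_
  · simp only [circleDisc, disc, coshLen]
    exact Continuous.continuousOn (by fun_prop)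
  · have h1 := Real.sqrt_pos.2 (circleDisc_pos h (hr i) (hr j) (hr k))
    have h2 := one_lt_coshLen (hr i) (hr j) h.hp h.hp1
    exact mul_ne_zero h1.ne' (by nlinarith)

theorem faceWeight_comm (hσ : IsGoodFace Φ σ) (hr : ∀ i, 0 < r i) (hi : i ∈ σ)
    (hj : j ∈ σ.erase i) : faceWeight Φ r σ j i = faceWeight Φ r σ i j := by
  obtain ⟨k, hij, hik, hjk, rfl, h⟩ := hσ i hi j hj
  have h' := h.swap₁₂
  rw [pair_comm i j] at h'
  rw [faceWeight_eq hr hij hik hjk h, insert_comm, faceWeight_eq hr hij.symm hjk hik h',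
    weight_swap₁₂, pair_comm i j]

/-- The third vertex of a face can be chosen for a given first one. -/
theorem exists_eq (hσ : IsGoodFace Φ σ) (hcard : σ.card = 3) (hi : i ∈ σ) :
    ∃ j k, i ≠ j ∧ i ≠ k ∧ j ≠ k ∧ σ = {i, j, k} ∧
      IsAdmissible (cos (Φ {i, j})) (cos (Φ {i, k})) (cos (Φ {j, k})) := by
  obtain ⟨j, hj⟩ : (σ.erase i).Nonempty := by
    rw [← card_pos, card_erase_of_mem hi]
    omega
  exact ⟨j, hσ i hi j hj⟩

theorem continuousOn_angle (hσ : IsGoodFace Φ σ) (hcard : σ.card = 3) (hi : i ∈ σ) :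
    ContinuousOn (fun r => angle Φ r σ i) {r | ∀ i, 0 < r i} := by
  obtain ⟨j, k, hij, hik, hjk, rfl, h⟩ := hσ.exists_eq hcard hi
  refine ContinuousOn.congr ?_ fun r hr => angle_eq hr hij hik hjk h
  unfold lawAngle
  refine continuous_arccos.comp_continuousOn (ContinuousOn.div ?_ ?_ fun r hr => ?_)
  · simp only [coshEdge, coshLen]
    exact Continuous.continuousOn (by fun_prop)
  · simp only [coshEdge, coshLen]
    exact Continuous.continuousOn (by fun_prop)
  · have h1 : 1 < coshEdge Φ r i j := one_lt_coshLen (hr i) (hr j) h.hp h.hp1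
    have h2 : 1 < coshEdge Φ r i k := one_lt_coshLen (hr i) (hr k) h.hq h.hq1
    exact mul_ne_zero (Real.sqrt_pos.2 (by nlinarith)).ne' (Real.sqrt_pos.2 (by nlinarith)).ne'

theorem partialU_angle_self (hσ : IsGoodFace Φ σ) (hcard : σ.card = 3) (hr : ∀ i, 0 < r i)
    (hi : i ∈ σ) : partialU (fun s => angle Φ s σ i) r i =
      -∑ j ∈ σ.erase i, coshEdge Φ r i j * faceWeight Φ r σ i j := by
  obtain ⟨j, k, hij, hik, hjk, rfl, h⟩ := hσ.exists_eq hcard hi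
  have he : ({i, j, k} : Finset V).erase i = {j, k} := erase_insert (by simp [hij, hik])
  have h' := h.swap₂₃
  rw [pair_comm j k] at h'
  rw [partialU_eq_of_hasDerivAt (hr i) (hasDerivAt_angle_self hr hij hik hjk h), he,
    sum_pair hjk, faceWeight_eq hr hij hik hjk h, pair_comm j k, faceWeight_eq hr hik hij hjk.symm h']

theorem differentiableAt_angle (hσ : IsGoodFace Φ σ) (hcard : σ.card = 3) (hr : ∀ i, 0 < r i)
    (hi : i ∈ σ) (m : V) :
    DifferentiableAt ℝ (fun s => angle Φ (Function.update r m s) σ i) (r m) := by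
  by_cases hm : m ∈ σ
  · rcases eq_or_ne m i with rfl | hmi
    · obtain ⟨j, k, hij, hik, hjk, rfl, h⟩ := hσ.exists_eq hcard hi
      exact (hasDerivAt_angle_self hr hij hik hjk h).differentiableAt
    · obtain ⟨k, hij, hik, hjk, rfl, h⟩ := hσ i hi m (mem_erase.2 ⟨hmi, hm⟩)
      exact (hasDerivAt_angle_other hr hij hik hjk h).differentiableAt
  · have : (fun s => angle Φ (Function.update r m s) σ i) = fun _ => angle Φ r σ i :=
      funext fun s => angle_congr (fun v hv => by simp [ne_of_mem_of_not_mem hv hm]) hi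
    rw [this]
    exact differentiableAt_const _

end IsGoodFace

theorem partialU_angle_of_notMem (hi : i ∈ σ) {m : V} (hm : m ∉ σ) :
    partialU (fun s => angle Φ s σ i) r m = 0 := by
  have : (fun s => angle Φ (Function.update r m s) σ i) = fun _ => angle Φ r σ i :=
    funext fun s => angle_congr (fun v hv => by simp [ne_of_mem_of_not_mem hv hm]) hi
  simp [partialU, this]

theorem partialU_sum {α : Type*} (s : Finset α) (f : α → (V → ℝ) → ℝ)
    (h : ∀ a ∈ s, DifferentiableAt ℝ (fun x => f a (Function.update r j x)) (r j)) :
    partialU (fun x => ∑ a ∈ s, f a x) r j = ∑ a ∈ s, partialU (f a) r j := by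
  simp only [partialU]
  rw [deriv_fun_sum h, mul_sum]

theorem partialU_const_sub (c : ℝ) (f : (V → ℝ) → ℝ) :
    partialU (fun x => c - f x) r j = -partialU f r j := by
  simp [partialU, deriv_const_sub]

/-- The own angle contributes w cosh l_ij and, by symmetry, the angle at j contributes -w. -/
theorem IsGoodFace.partialU_area (hσ : IsGoodFace Φ σ) (hcard : σ.card = 3) (hr : ∀ i, 0 < r i)
    (hi : i ∈ σ) : partialU (fun s => area Φ s σ) r i =
      ∑ j ∈ σ.erase i, faceWeight Φ r σ i j * (coshEdge Φ r i j - 1) := by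
  simp only [area]
  rw [partialU_const_sub, partialU_sum _ _ fun v hv => hσ.differentiableAt_angle hcard hr hv i,
    ← add_sum_erase _ _ hi, hσ.partialU_angle_self hcard hr hi, neg_add, neg_neg,
    ← sum_neg_distrib, ← sum_add_distrib]
  refine sum_congr rfl fun j hj => ?_
  have : partialU (fun s => angle Φ s σ j) r i = faceWeight Φ r σ i j := hσ.faceWeight_comm hr hi hj
  rw [this]
  ring

theorem IsGoodFace.eventually_angle_le {σ : Finset V} (hσ : IsGoodFace Φ σ) (hcard : σ.card = 3)
    (hi : i ∈ σ) {ε : ℝ} (hε : 0 < ε) (hεπ : ε ≤ π) :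
    ∀ᶠ L in atTop, ∀ r : V → ℝ, (∀ i, 0 < r i) → L ≤ r i → angle Φ r σ i ≤ ε := by
  obtain ⟨j, k, hij, hik, hjk, rfl, h⟩ := hσ.exists_eq hcard hi
  have hp := h.hp
  have hq := h.hq
  set κ := (1 + cos (Φ {i, j})) * (1 + cos (Φ {i, k})) with hκ
  have hκ0 : 0 < κ := mul_pos (by linarith) (by linarith)
  have hcos : cos ε < 1 := by
    rw [← cos_zero]
    exact cos_lt_cos_of_nonneg_of_le_pi le_rfl hεπ hε
  have hsinh : Tendsto sinh atTop atTop :=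
    tendsto_atTop_mono' _ ((eventually_ge_atTop 0).mono fun x hx => self_le_sinh_iff.2 hx)
      tendsto_id
  have hlim : Tendsto (fun a => 8 / (κ * sinh a ^ 2)) atTop (nhds 0) :=
    tendsto_const_nhds.div_atTop (((tendsto_pow_atTop two_ne_zero).comp hsinh).const_mul_atTop hκ0)
  have hev : ∀ᶠ L in atTop, ∀ a, L ≤ a → 8 / (κ * sinh a ^ 2) < 1 - cos ε :=
    eventually_forall_ge_atTop.2 (hlim.eventually_lt_const (by linarith))
  filter_upwards [hev] with L hL r hr hLr
  rw [angle_eq hr hij hik hjk h, lawAngle, ← arccos_cos hε.le hεπ]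
  refine antitone_arccos (le_trans ?_ (one_sub_cos_le h (hr i) (hr j) (hr k)))
  linarith [hL _ hLr]

theorem IsGoodFace.eventually_le_coshEdge {σ : Finset V} (hσ : IsGoodFace Φ σ) (hi : i ∈ σ)
    (hj : j ∈ σ.erase i) (M : ℝ) :
    ∀ᶠ L in atTop, ∀ r : V → ℝ, (∀ i, 0 < r i) → L ≤ r i → M ≤ coshEdge Φ r i j - 1 := by
  obtain ⟨k, hij, hik, hjk, rfl, h⟩ := hσ i hi j hj
  have hp : 0 < (1 + cos (Φ {i, j})) / 2 := by linarith [h.hp]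
  filter_upwards [eventually_ge_atTop (M / ((1 + cos (Φ {i, j})) / 2) + 1), eventually_ge_atTop 0]
    with L hL hL0 r hr hLr
  refine le_trans ?_ (coshLen_sub_one_ge_cosh (hr i) (hr j) h.hp h.hp1)
  have h1 : r i ≤ cosh (r i) := (self_le_sinh_iff.2 (hr i).le).trans (sinh_lt_cosh _).le
  rw [mul_comm, ← div_le_iff₀ hp]
  linarith

end CirclePacking

/-! ### Signed powers and the passage between r and u. -/

namespace CirclePacking

open Real HypTriangle Filter

/-- The odd extension of `d ↦ d ^ (p - 1)`. -/
noncomputable def signedPow (p d : ℝ) : ℝ := |d| ^ (p - 2) * d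

theorem abs_signedPow {p : ℝ} (hp : 1 < p) (d : ℝ) : |signedPow p d| = |d| ^ (p - 1) := by
  rw [signedPow, abs_mul, abs_of_nonneg (rpow_nonneg (abs_nonneg d) _)]
  rcases eq_or_ne d 0 with rfl | hd
  · rw [abs_zero, mul_zero, zero_rpow (by linarith)]
  · rw [← rpow_add_one (abs_ne_zero.2 hd)]
    ring_nf

theorem signedPow_le {p d B : ℝ} (hp : 1 < p) (hd : d ≤ B) (hB : 0 ≤ B) :
    signedPow p d ≤ B ^ (p - 1) := by
  rcases le_total d 0 with h | h
  · exact (mul_nonpos_of_nonneg_of_nonpos (rpow_nonneg (abs_nonneg d) _) h).trans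
      (rpow_nonneg hB _)
  · refine (le_abs_self _).trans ?_
    rw [abs_signedPow hp, abs_of_nonneg h]
    exact rpow_le_rpow h hd (by linarith)

/-- At 0 the factor |d|^(p-2) may blow up, but the absolute value of the product is |d|^(p-1), which
tends to 0 because p > 1. -/
theorem continuous_signedPow {p : ℝ} (hp : 1 < p) : Continuous (signedPow p) := by
  rw [continuous_iff_continuousAt]
  intro d
  rcases eq_or_ne d 0 with rfl | hd
  · have h0 : signedPow p 0 = 0 := by simp [signedPow]
    rw [ContinuousAt, h0, tendsto_zero_iff_abs_tendsto_zero]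
    have h1 : Tendsto (fun d : ℝ => |d| ^ (p - 1)) (nhds 0) (nhds (|(0 : ℝ)| ^ (p - 1))) :=
      (continuous_abs.rpow_const fun _ => Or.inr (by linarith)).tendsto 0
    rw [abs_zero, zero_rpow (by linarith)] at h1
    exact h1.congr fun d => (abs_signedPow hp d).symm
  · exact (continuous_abs.continuousAt.rpow_const (Or.inl (abs_ne_zero.2 hd))).mul continuousAt_id

theorem signedPow_two (d : ℝ) : signedPow 2 d = d := by simp [signedPow]

section Radius

/-- The inverse of `uCoord`. -/
noncomputable def radius (u : ℝ) : ℝ := 2 * artanh (exp u)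

theorem exp_mem_Ioo {u : ℝ} (hu : u < 0) : exp u ∈ Set.Ioo (-1) 1 :=
  ⟨by linarith [exp_pos u], exp_lt_one_iff.2 hu⟩

theorem radius_pos {u : ℝ} (hu : u < 0) : 0 < radius u :=
  mul_pos two_pos (artanh_pos ⟨exp_pos u, exp_lt_one_iff.2 hu⟩)

theorem uCoord_radius {u : ℝ} (hu : u < 0) : uCoord (radius u) = u := by
  rw [uCoord, radius, mul_div_cancel_left₀ _ two_ne_zero, tanh_artanh (exp_mem_Ioo hu), log_exp]

theorem tanh_half_pos {x : ℝ} (hx : 0 < x) : 0 < tanh (x / 2) := by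
  rw [tanh_eq_sinh_div_cosh]
  exact div_pos (sinh_pos_iff.2 (by positivity)) (cosh_pos _)

theorem uCoord_neg {x : ℝ} (hx : 0 < x) : uCoord x < 0 :=
  log_neg (tanh_half_pos hx) (tanh_lt_one _)

theorem radius_uCoord {x : ℝ} (hx : 0 < x) : radius (uCoord x) = x := by
  rw [uCoord, radius, exp_log (tanh_half_pos hx), artanh_tanh]
  ring

theorem radius_le_radius {u v : ℝ} (hv : v < 0) (huv : u ≤ v) : radius u ≤ radius v :=
  mul_le_mul_of_nonneg_left
    (artanh_le_artanh (exp_mem_Ioo (huv.trans_lt hv)).1 (exp_lt_one_iff.2 hv) (exp_le_exp.2 huv))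
    zero_le_two

theorem continuousOn_radius : ContinuousOn radius (Set.Iio 0) := by
  unfold radius artanh
  refine continuousOn_const.mul (ContinuousOn.log (ContinuousOn.sqrt (ContinuousOn.div
    (by fun_prop) (by fun_prop) fun u hu => ?_)) fun u hu => ?_)
  · linarith [exp_lt_one_iff.2 hu]
  · have h1 := exp_lt_one_iff.2 hu
    have h2 := exp_pos u
    exact (Real.sqrt_pos.2 (div_pos (by linarith) (by linarith))).ne'

open BoundedField

variable {V : Type*} {X : (V → ℝ) → V → ℝ} {I : Set ℝ}

theorem isSolutionOn_radius {u : ℝ → V → ℝ}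
    (hu : IsNegSolutionOn (fun x => X fun i => radius (x i)) I u) :
    IsSolutionOn X I (fun t i => radius (u t i)) := fun t ht i =>
  ⟨radius_pos (hu t ht i).1, (hu t ht i).2.congr (fun s hs => uCoord_radius (hu s hs i).1)
    (uCoord_radius (hu t ht i).1)⟩

theorem isNegSolutionOn_uCoord {r : ℝ → V → ℝ}
    (hr : IsSolutionOn X I r) :
    IsNegSolutionOn (fun x => X fun i => radius (x i)) I (fun t i => uCoord (r t i)) := by
  intro t ht i
  refine ⟨uCoord_neg (hr t ht i).1, ?_⟩
  have : (fun i => radius (uCoord (r t i))) = r t := funext fun j => radius_uCoord (hr t ht j).1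
  simp only [this]
  exact (hr t ht i).2

theorem isSolutionOn_congr {Y : (V → ℝ) → V → ℝ}
    (h : ∀ r : V → ℝ, (∀ i, 0 < r i) → X r = Y r) : IsSolutionOn X = IsSolutionOn Y := by
  funext I r
  refine propext (forall₂_congr fun t _ => ?_)
  constructor <;> intro hr i <;> refine ⟨(hr i).1, ?_⟩
  · rw [← h _ fun j => (hr j).1]
    exact (hr i).2
  · rw [h _ fun j => (hr j).1]
    exact (hr i).2

/-- Long time existence for a continuous flow that is bounded on bounded circle packing metrics and
does not increase radii above a certain bound. -/
theorem longTimeExistence_of_barrier [Fintype V]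
    (hcont : ContinuousOn X {r | ∀ i, 0 < r i})
    (hbar : ∃ L > 0, ∀ r : V → ℝ, (∀ i, 0 < r i) → ∀ i, L ≤ r i → X r i ≤ 0)
    (hbdd : ∀ R, ∃ C, ∀ r : V → ℝ, (∀ i, 0 < r i ∧ r i ≤ R) → ∀ i, |X r i| ≤ C)
    {r₀ : V → ℝ} (hr₀ : ∀ i, 0 < r₀ i) : LongTimeExistence (IsSolutionOn X) r₀ := by
  obtain ⟨L, hL0, hL⟩ := hbar
  set F : (V → ℝ) → V → ℝ := fun x => X fun i => radius (x i) with hF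
  have hFcont : ContinuousOn F {x | ∀ i, x i < 0} :=
    hcont.comp (continuousOn_pi.2 fun i => continuousOn_radius.comp
      (continuous_apply i).continuousOn fun x hx => hx i) fun x hx i => radius_pos (hx i)
  have hFbar : ∀ x : V → ℝ, (∀ i, x i < 0) → ∀ i, uCoord L ≤ x i → F x i ≤ 0 :=
    fun x hx i hi => hL _ (fun j => radius_pos (hx j)) i
      ((radius_uCoord hL0).symm.le.trans (radius_le_radius (hx i) hi))
  have hFbdd : ∀ M < 0, ∃ C, ∀ x : V → ℝ, (∀ i, x i ≤ M) → ∀ i, |F x i| ≤ C := fun M hM => by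
    obtain ⟨C, hC⟩ := hbdd (radius M)
    exact ⟨C, fun x hx => hC _ fun i =>
      ⟨radius_pos ((hx i).trans_lt hM), radius_le_radius hM (hx i)⟩⟩
  constructor
  · obtain ⟨u, hu0, hu⟩ := exists_isNegSolutionOn_Ici (uCoord_neg hL0) hFcont hFbar hFbdd
      (x₀ := fun i => uCoord (r₀ i)) fun i => uCoord_neg (hr₀ i)
    refine ⟨_, ?_, isSolutionOn_radius hu⟩
    funext i
    simp [hu0, radius_uCoord (hr₀ i)]
  · intro τ hτ ρ _ hρ
    obtain ⟨u, huρ, hu⟩ := (isNegSolutionOn_uCoord hρ).exists_extension (uCoord_neg hL0) hFcont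
      hFbar hFbdd hτ
    refine ⟨_, fun t ht => ?_, isSolutionOn_radius hu⟩
    funext i
    simp [huρ ht, radius_uCoord (hρ t ht i).1]

end Radius

/-! ### The two Laplacians as sums over faces. -/

variable {V : Type*} [Fintype V] [DecidableEq V]

theorem isGoodFace_of_mem (T : SurfaceTriangulation V) {Φ : Finset V → ℝ} (hΦ : T.IsWeight Φ)
    (hstar : T.StarCondition Φ) {σ : Finset V} (hσ : σ ∈ T.faces) : IsGoodFace Φ σ := by
  intro i hi j hj
  have hij : i ≠ j := (ne_of_mem_erase hj).symm
  obtain ⟨k, hk⟩ : ∃ k, (σ.erase i).erase j = {k} := by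
    rw [← card_eq_one, card_erase_of_mem hj, card_erase_of_mem hi, T.card_face σ hσ]
  have hs : σ = {i, j, k} := by
    rw [← insert_erase hi, ← insert_erase hj, hk]
  have hk' : k ∈ (σ.erase i).erase j := by simp [hk]
  have hjk : j ≠ k := (ne_of_mem_erase hk').symm
  have hik : i ≠ k := (ne_of_mem_erase (mem_of_mem_erase hk')).symm
  refine ⟨k, hij, hik, hjk, hs, ?_⟩
  have hcos : ∀ a b, a ≠ b → a ∈ σ → b ∈ σ → -1 < cos (Φ {a, b}) := fun a b hab ha hb => by
    obtain ⟨h0, h1⟩ := hΦ {a, b} (by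
      simp only [SurfaceTriangulation.edges, mem_filter, mem_univ, true_and]
      exact ⟨card_pair hab, σ, hσ, by simp [insert_subset_iff, ha, hb]⟩)
    rw [← cos_pi]
    exact cos_lt_cos_of_nonneg_of_le_pi h0 le_rfl h1
  have hjσ : j ∈ σ := mem_of_mem_erase hj
  have hkσ : k ∈ σ := mem_of_mem_erase (mem_of_mem_erase hk')
  have h1 := hstar i j k (hs ▸ hσ)
  have h2 := hstar i k j (by rw [pair_comm]; exact hs ▸ hσ)
  have h3 := hstar j k i (by
    rw [show ({j, k, i} : Finset V) = {i, j, k} by ext; simp; tauto]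
    exact hs ▸ hσ)
  rw [pair_comm k j] at h2
  rw [pair_comm j i, pair_comm k i] at h3
  exact ⟨hcos _ _ hij hi hjσ, cos_le_one _, hcos _ _ hik hi hkσ, cos_le_one _,
    hcos _ _ hjk hjσ hkσ, cos_le_one _, h1, h2, h3⟩

variable {T : SurfaceTriangulation V} {Φ : Finset V → ℝ} {r : V → ℝ} {i j : V}

theorem coeffB_eq (hT : ∀ σ ∈ T.faces, IsGoodFace Φ σ) (hr : ∀ i, 0 < r i) (i j : V) :
    coeffB T Φ r i j = ∑ σ ∈ T.faces.filter (fun σ => {i, j} ⊆ σ), faceWeight Φ r σ i j :=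
  partialU_sum _ _ fun σ hσ => by
    rw [mem_filter, insert_subset_iff] at hσ
    exact (hT σ hσ.1).differentiableAt_angle (T.card_face σ hσ.1) hr hσ.2.1 j

theorem coeffA_eq (hT : ∀ σ ∈ T.faces, IsGoodFace Φ σ) (hr : ∀ i, 0 < r i) (i : V) :
    coeffA T Φ r i = ∑ σ ∈ T.faces.filter (fun σ => i ∈ σ),
      ∑ j ∈ σ.erase i, faceWeight Φ r σ i j * (coshEdge Φ r i j - 1) := by
  rw [coeffA, partialU_sum]
  · refine sum_congr rfl fun σ hσ => ?_
    rw [mem_filter] at hσ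
    exact (hT σ hσ.1).partialU_area (T.card_face σ hσ.1) hr hσ.2
  · intro σ hσ
    rw [mem_filter] at hσ
    exact (DifferentiableAt.fun_sum fun v hv =>
      (hT σ hσ.1).differentiableAt_angle (T.card_face σ hσ.1) hr hv i).const_sub _

/-- Both B_ij and A_i split over faces with the same weights; exchanging the sums over edges and
over their faces brings them together. -/
theorem pLaplacian_eq (hT : ∀ σ ∈ T.faces, IsGoodFace Φ σ) (hr : ∀ i, 0 < r i) (p : ℝ)
    (f : V → ℝ) (i : V) :
    pLaplacian T Φ p r f i = ∑ σ ∈ T.faces.filter (fun σ => i ∈ σ), ∑ j ∈ σ.erase i,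
      faceWeight Φ r σ i j * (signedPow p (f j - f i) - (coshEdge Φ r i j - 1) * f i) := by
  have h1 : ∑ j ∈ univ.filter (fun j => {i, j} ∈ T.edges),
      coeffB T Φ r i j * (|f j - f i| ^ (p - 2) * (f j - f i)) =
      ∑ σ ∈ T.faces.filter (fun σ => i ∈ σ), ∑ j ∈ σ.erase i,
        faceWeight Φ r σ i j * signedPow p (f j - f i) := by
    simp only [coeffB_eq hT hr, sum_mul]
    refine sum_comm' fun j σ => ?_
    simp only [SurfaceTriangulation.edges, mem_filter, mem_univ, true_and, insert_subset_iff,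
      singleton_subset_iff, mem_erase]
    constructor
    · rintro ⟨⟨hc, -⟩, hσ, hi, hj⟩
      refine ⟨⟨?_, hj⟩, hσ, hi⟩
      rintro rfl
      simp at hc
    · rintro ⟨⟨hji, hj⟩, hσ, hi⟩
      exact ⟨⟨card_pair hji.symm, σ, hσ, hi, hj⟩, hσ, hi, hj⟩
  rw [pLaplacian, h1, coeffA_eq hT hr, sum_mul, ← sum_sub_distrib]
  refine sum_congr rfl fun σ _ => ?_
  rw [sum_mul, ← sum_sub_distrib]
  exact sum_congr rfl fun j _ => by ring

theorem laplacian_eq_pLaplacian_two (hT : ∀ σ ∈ T.faces, IsGoodFace Φ σ) (hr : ∀ i, 0 < r i)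
    (f : V → ℝ) (i : V) : laplacian T Φ r f i = pLaplacian T Φ 2 r f i := by
  have hK : ∀ j, partialU (fun s => curvature T Φ s j) r i =
      -∑ σ ∈ T.faces.filter (fun σ => j ∈ σ), partialU (fun s => angle Φ s σ j) r i := fun j => by
    simp only [curvature]
    rw [partialU_const_sub, partialU_sum]
    intro σ hσ
    rw [mem_filter] at hσ
    exact (hT σ hσ.1).differentiableAt_angle (T.card_face σ hσ.1) hr hσ.2 i
  rw [pLaplacian_eq hT hr, laplacian]
  simp only [hK, neg_mul, sum_neg_distrib, neg_neg, sum_mul]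
  rw [sum_comm' (t' := T.faces) (s' := fun σ => σ) (fun j σ => by simp [and_comm])]
  -- The angles of a face that does not contain i do not depend on r_i.
  rw [← sum_filter_of_ne (p := fun σ => i ∈ σ)]
  · refine sum_congr rfl fun σ hσ => ?_
    rw [mem_filter] at hσ
    have hg := hT σ hσ.1
    rw [← add_sum_erase _ _ hσ.2, hg.partialU_angle_self (T.card_face σ hσ.1) hr hσ.2, neg_mul,
      sum_mul, neg_add_eq_sub, ← sum_sub_distrib]
    refine sum_congr rfl fun j hj => ?_
    have : partialU (fun s => angle Φ s σ j) r i = faceWeight Φ r σ i j :=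
      hg.faceWeight_comm hr hσ.2 hj
    rw [this, signedPow_two]
    ring
  · intro σ _ hne
    by_contra hi
    exact hne (sum_eq_zero fun j hj => by rw [partialU_angle_of_notMem hj hi, zero_mul])

/-! ### Barrier, bound and continuity for the flow field. -/

theorem curvature_le (T : SurfaceTriangulation V) (Φ : Finset V → ℝ) (r : V → ℝ) (i : V) :
    curvature T Φ r i ≤ 2 * π :=
  sub_le_self _ (sum_nonneg fun _ _ => arccos_nonneg _)

theorem abs_curvature_le (T : SurfaceTriangulation V) (Φ : Finset V → ℝ) (r : V → ℝ) (i : V) :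
    |curvature T Φ r i| ≤ 2 * π + T.faces.card * π := by
  have h1 : ∑ σ ∈ T.faces.filter (fun σ => i ∈ σ), angle Φ r σ i ≤ T.faces.card * π := by
    refine (sum_le_card_nsmul _ _ π fun _ _ => arccos_le_pi _).trans ?_
    rw [nsmul_eq_mul]
    gcongr
    exact filter_subset _ _
  have h2 := curvature_le T Φ r i
  have h3 : 0 ≤ (T.faces.card : ℝ) * π := by positivity
  rw [abs_le]
  refine ⟨?_, by linarith⟩
  rw [curvature]
  linarith [pi_pos]

theorem exists_barrier (hT : ∀ σ ∈ T.faces, IsGoodFace Φ σ) {p : ℝ} (hp : 1 < p) :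
    ∃ L > 0, ∀ r : V → ℝ, (∀ i, 0 < r i) → ∀ i, L ≤ r i →
      pLaplacian T Φ p r (curvature T Φ r) i ≤ 0 := by
  -- With angles of at most ε, the angle sum at i is at most π, whence K_i ≥ π.
  set ε := π / (T.faces.card + 1) with hε
  have hε0 : 0 < ε := by positivity
  have hεπ : ε ≤ π := div_le_self pi_pos.le (by simp)
  have h1 : ∀ᶠ L in atTop, ∀ i, ∀ σ ∈ T.faces.filter (fun σ => i ∈ σ), ∀ r : V → ℝ,
      (∀ i, 0 < r i) → L ≤ r i → angle Φ r σ i ≤ ε := by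
    rw [eventually_all]
    intro i
    rw [eventually_all_finset]
    intro σ hσ
    rw [mem_filter] at hσ
    exact (hT σ hσ.1).eventually_angle_le (T.card_face σ hσ.1) hσ.2 hε0 hεπ
  -- The threshold makes (cosh l_ij - 1) K_i ≥ π^(p-1) once K_i ≥ π. This matches the upper bound
  -- π^(p-1) of the signed power of K_j - K_i ≤ π.
  have h2 : ∀ᶠ L in atTop, ∀ i, ∀ σ ∈ T.faces.filter (fun σ => i ∈ σ), ∀ j ∈ σ.erase i,
      ∀ r : V → ℝ, (∀ i, 0 < r i) → L ≤ r i → π ^ (p - 1) / π ≤ coshEdge Φ r i j - 1 := by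
    rw [eventually_all]
    intro i
    rw [eventually_all_finset]
    intro σ hσ
    rw [eventually_all_finset]
    intro j hj
    rw [mem_filter] at hσ
    exact (hT σ hσ.1).eventually_le_coshEdge hσ.2 hj _
  obtain ⟨L, hL0, hL1, hL2⟩ := ((eventually_gt_atTop 0).and (h1.and h2)).exists
  refine ⟨L, hL0, fun r hr i hi => ?_⟩
  have hK : π ≤ curvature T Φ r i := by
    have : ∑ σ ∈ T.faces.filter (fun σ => i ∈ σ), angle Φ r σ i ≤ π := by
      refine (sum_le_card_nsmul _ _ ε fun σ hσ => hL1 i σ hσ r hr hi).trans ?_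
      rw [nsmul_eq_mul]
      have hc : (((T.faces.filter (fun σ => i ∈ σ)).card : ℕ) : ℝ) ≤ T.faces.card + 1 := by
        have := card_le_card (filter_subset (fun σ => i ∈ σ) T.faces)
        have h' : (((T.faces.filter (fun σ => i ∈ σ)).card : ℕ) : ℝ) ≤ T.faces.card := by
          exact_mod_cast this
        linarith
      calc _ ≤ ((T.faces.card : ℝ) + 1) * ε := by gcongr
        _ = π := by rw [hε]; field_simp
    rw [curvature]
    linarith
  rw [pLaplacian_eq hT hr]
  refine sum_nonpos fun σ hσ => sum_nonpos fun j hj => mul_nonpos_of_nonneg_of_nonpos ?_ ?_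
  · rw [mem_filter] at hσ
    exact (hT σ hσ.1).faceWeight_nonneg hr hσ.2 hj
  · have e1 : signedPow p (curvature T Φ r j - curvature T Φ r i) ≤ π ^ (p - 1) :=
      signedPow_le hp (by linarith [curvature_le T Φ r j]) pi_pos.le
    have e2 := hL2 i σ hσ j hj r hr hi
    have e3 : π ^ (p - 1) / π * π ≤ (coshEdge Φ r i j - 1) * curvature T Φ r i :=
      mul_le_mul e2 hK pi_pos.le ((by positivity : (0 : ℝ) ≤ π ^ (p - 1) / π).trans e2)
    rw [div_mul_cancel₀ _ pi_pos.ne'] at e3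
    linarith

theorem exists_bound_sum {α β : Type*} {S : Set β} (s : Finset α) {g : α → β → ℝ}
    (h : ∀ a ∈ s, ∃ C, ∀ x ∈ S, |g a x| ≤ C) : ∃ C, ∀ x ∈ S, |∑ a ∈ s, g a x| ≤ C := by
  choose! C hC using h
  exact ⟨∑ a ∈ s, C a, fun x hx =>
    (abs_sum_le_sum_abs _ _).trans (sum_le_sum fun a ha => hC a ha x hx)⟩

theorem exists_pLaplacian_bound (hT : ∀ σ ∈ T.faces, IsGoodFace Φ σ) {p : ℝ} (hp : 1 < p) (R : ℝ) :
    ∃ C, ∀ r : V → ℝ, (∀ i, 0 < r i ∧ r i ≤ R) → ∀ i,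
      |pLaplacian T Φ p r (curvature T Φ r) i| ≤ C := by
  have hi : ∀ i, ∃ C, ∀ r ∈ {r : V → ℝ | ∀ i, 0 < r i ∧ r i ≤ R},
      |∑ σ ∈ T.faces.filter (fun σ => i ∈ σ), ∑ j ∈ σ.erase i,
        faceWeight Φ r σ i j * (signedPow p (curvature T Φ r j - curvature T Φ r i) -
          (coshEdge Φ r i j - 1) * curvature T Φ r i)| ≤ C := by
    intro i
    refine exists_bound_sum _ fun σ hσ => exists_bound_sum _ fun j hj => ?_
    rw [mem_filter] at hσ
    obtain ⟨C, hC⟩ := (hT σ hσ.1).exists_faceWeight_bound hσ.2 hj R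
    obtain ⟨k, hij, -, -, -, hadm⟩ := hT σ hσ.1 i hσ.2 j hj
    -- B bounds |K|, so |K_j - K_i| ≤ B + B. The remaining factors are bounded by values at R alone,
    -- hence also near zero radii.
    set B := 2 * π + T.faces.card * π with hB
    have hB0 : 0 ≤ B := by positivity
    refine ⟨C * ((B + B) ^ (p - 1) + 2 * (cosh R * cosh R) * B), fun r hr => ?_⟩
    have hr0 : ∀ i, 0 < r i := fun i => (hr i).1
    have hc : ∀ i, cosh (r i) ≤ cosh R := fun i => by
      rw [cosh_le_cosh, abs_of_pos (hr0 i), abs_of_pos ((hr0 i).trans_le (hr i).2)]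
      exact (hr i).2
    have hKi := abs_curvature_le T Φ r i
    have hKj := abs_curvature_le T Φ r j
    have hx1 : 1 < coshEdge Φ r i j := one_lt_coshLen (hr0 i) (hr0 j) hadm.hp hadm.hp1
    have hx2 : coshEdge Φ r i j - 1 ≤ 2 * (cosh R * cosh R) := by
      have h1 : coshEdge Φ r i j ≤ 2 * (cosh (r i) * cosh (r j)) :=
        coshLen_le (hr0 i) (hr0 j) hadm.hp1
      have h2 := mul_le_mul (hc i) (hc j) (cosh_pos _).le (cosh_pos _).le
      linarith
    rw [abs_mul]
    refine mul_le_mul (hC r hr) ?_ (abs_nonneg _) ((abs_nonneg _).trans (hC r hr))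
    refine (abs_sub _ _).trans (add_le_add ?_ ?_)
    · rw [abs_signedPow hp]
      exact rpow_le_rpow (abs_nonneg _) ((abs_sub _ _).trans (add_le_add hKj hKi)) (by linarith)
    · rw [abs_mul, abs_of_pos (sub_pos.2 hx1)]
      exact mul_le_mul hx2 hKi (abs_nonneg _) ((sub_pos.2 hx1).le.trans hx2)
  choose C hC using hi
  refine ⟨∑ i, |C i|, fun r hr i => ?_⟩
  rw [pLaplacian_eq hT fun i => (hr i).1]
  exact (hC i r hr).trans ((le_abs_self _).trans
    (single_le_sum (f := fun i => |C i|) (fun _ _ => abs_nonneg _) (mem_univ i)))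

theorem continuousOn_curvature (hT : ∀ σ ∈ T.faces, IsGoodFace Φ σ) (i : V) :
    ContinuousOn (fun r => curvature T Φ r i) {r | ∀ i, 0 < r i} := by
  unfold curvature
  refine continuousOn_const.sub (continuousOn_finsetSum _ fun σ hσ => ?_)
  rw [mem_filter] at hσ
  exact (hT σ hσ.1).continuousOn_angle (T.card_face σ hσ.1) hσ.2

theorem continuousOn_pLaplacian (hT : ∀ σ ∈ T.faces, IsGoodFace Φ σ) {p : ℝ} (hp : 1 < p) :
    ContinuousOn (fun r => pLaplacian T Φ p r (curvature T Φ r)) {r | ∀ i, 0 < r i} := by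
  refine continuousOn_pi.2 fun i => ContinuousOn.congr ?_ fun r hr => pLaplacian_eq hT hr p _ i
  refine continuousOn_finsetSum _ fun σ hσ => continuousOn_finsetSum _ fun j hj => ?_
  rw [mem_filter] at hσ
  refine ((hT σ hσ.1).continuousOn_faceWeight hσ.2 hj).mul (ContinuousOn.sub ?_ ?_)
  · exact (continuous_signedPow hp).comp_continuousOn
      ((continuousOn_curvature hT j).sub (continuousOn_curvature hT i))
  · refine ContinuousOn.mul (Continuous.continuousOn ?_) (continuousOn_curvature hT i)
    unfold coshEdge coshLen
    fun_prop

end CirclePacking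

theorem theorem1p3 {V : Type*} [Fintype V] [DecidableEq V] (T : SurfaceTriangulation V)
    (Φ : Finset V → ℝ) (hΦ : T.IsWeight Φ) (hstar : T.StarCondition Φ)
    (r₀ : V → ℝ) (hr₀ : ∀ i, 0 < r₀ i) :
    CirclePacking.LongTimeExistence (CirclePacking.IsCalabiFlow T Φ) r₀ ∧
    ∀ p : ℝ, 1 < p →
      CirclePacking.LongTimeExistence (CirclePacking.IsPCalabiFlow T Φ p) r₀ := by
  open CirclePacking in
  have hT : ∀ σ ∈ T.faces, IsGoodFace Φ σ := fun σ hσ => isGoodFace_of_mem T hΦ hstar hσ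
  have hmain : ∀ p : ℝ, 1 < p → LongTimeExistence (IsPCalabiFlow T Φ p) r₀ := fun p hp =>
    longTimeExistence_of_barrier (continuousOn_pLaplacian hT hp) (exists_barrier hT hp)
      (exists_pLaplacian_bound hT hp) hr₀
  have hcalabi : IsCalabiFlow T Φ = IsPCalabiFlow T Φ 2 := isSolutionOn_congr
    (X := fun r => laplacian T Φ r (curvature T Φ r))
    (Y := fun r => pLaplacian T Φ 2 r (curvature T Φ r)) fun r hr => funext fun i => laplacian_eq_pLaplacian_two hT hr _ i
  exact ⟨hcalabi ▸ hmain 2 one_lt_two, hmain⟩
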